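/- **Setting.** A cut and project scheme (CPS) $(G,H,\mathcal L)$ consists of locally compact abelian groups $G,H$ and a discrete co-compact subgroup $\mathcal L\subseteq G\times H$ such that the projection $\pi_G$ is injective on $\mathcal L$ and $L^*=\pi_H(\mathcal L)$ is dense in $H$. For a window $W\subseteq H$ put $\Lambda(W)=\{g\in G : (g,h)\in\mathcal L \text{ for some } h\in W\}$. A non-empty compact set $W$ is called proper if $\overline{\mathrm{int}(W)}=W$. For Delone sets $\Gamma,\Gamma'\subseteq G$ (here $G=\mathbb R^N$ or $\mathbb R$) let $d(\Gamma,\Gamma')$ be the minimum of $1/\sqrt2$ and of the infimum of all $\varepsilon>0$ for which there is $\delta\in B_\varepsilon(0)$ with $(\Gamma-\delta)\cap B_{1/\varepsilon}(0)=\Gamma'\cap B_{1/\varepsilon}(0)$. The hull $\Omega(\Gamma)$ is the closure of $\{\Gamma-g : g\in G\}$ in the space of Delone sets, and $G$ acts on it by $\varphi_g(\Gamma')=\Gamma'-g$. Given a van Hove sequence $(F_n)$ in $G$ and $C\subseteq\Omega(\Gamma)$, the topological entropy on $C$ is $$h^C_{\mathrm{top}}(\varphi)=\lim_{\varepsilon\to0}\limsup_{n\to\infty}\frac{\log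 S^C(\varepsilon,n)}{\mathrm{Leb}(F_n)},$$ where $S^C(\varepsilon,n)$ is the minimal cardinality of a set $S\subseteq\Omega(\Gamma)$ such that each $\zeta\in C$ admits $\eta\in S$ with $d(\zeta-s,\eta-s)<\varepsilon$ for all $s\in F_n$. The topological entropy of $\varphi$ is $h_{\mathrm{top}}(\varphi)=h_{\mathrm{top}}^{\Omega(\Gamma)}(\varphi)$. The torus parametrisation of a CPS $(\mathbb R^N,\mathbb R,\mathcal L)$ with proper window $W$ is the continuous surjection $\beta:\Omega(\Lambda(W))\to\mathbb T=(\mathbb R^N\times\mathbb R)/\mathcal L$ with $\beta(\Lambda(W))=[0,0]$ and $\beta(\Gamma-u)=\beta(\Gamma)+[u,0]$ for all $u\in\mathbb R^N$. Write $\mathcal L=A(\mathbb Z^{N+1})$ with $A=(a_{jk})\in\mathrm{GL}(N+1,\mathbb R)$, where the last row of $A$ is the component in the internal space. For $1\le i\le N$ let $$\mathcal L_i=A_i(\mathbb Z^2)\subseteq\mathbb R\times\mathbb R,\qquad A_i=\begin{pmatrix}a_{i,i}&a_{i,N+1}\\ a_{N+1,i}&a_{N+1,N+1}\end{pmatrix}.$$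 When $(\mathbb R,\mathbb R,\mathcal L_i)$ is a CPS, put $\Lambda_i(W)=\{x\in\mathbb R : (x,y)\in\mathcal L_i\text{ for some }y\in W\}$ and let $\varphi_i$ be the translation action of $\mathbb R$ on $\Omega(\Lambda_i(W))$. **Theorem.** Let $(\mathbb R^N,\mathbb R,\mathcal L)$ be a CPS with $\mathcal L=A(\mathbb Z^{N+1})$ as above, and let $W\subseteq\mathbb R$ be a proper window such that the translation action $\varphi$ of $\mathbb R^N$ on $\Omega(\Lambda(W))$ is minimal (as is the case, for instance, if $\partial W\cap L^*=\emptyset$, which can be achieved by a translation of $W$). Suppose that for some $i\in\{1,\dots,N\}$ the triple $(\mathbb R,\mathbb R,\mathcal L_i)$ is a CPS and $h_{\mathrm{top}}(\varphi_i)=0$ with respect to some van Hove sequence in $\mathbb R$. Then the torus parametrisation $\beta:\Omega(\Lambda(W))\to\mathbb T$ exists, and for every van Hove sequence in $\mathbb R^N$ each of its fibres has zero topological entropy: $$h_{\mathrm{top}}^{\beta^{-1}(\xi)}(\varphi)=0\quad\text{for all }\xi\in\mathbb T.$$ -/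

import Mathlib

open Set Filter Topology MeasureTheory
open scoped ENNReal Pointwise

noncomputable section

namespace CutProject

/-! ### Topological entropy of a group action along a van Hove sequence -/

section Entropy

variable {T : Type*} [AddCommGroup T] [TopologicalSpace T]

/-- The `K`-boundary of a subset `A` of a topological group. -/
def vanHoveBoundary (K A : Set T) : Set T :=
  ((K + A) \ interior A) ∪ ((closure Aᶜ + K) ∩ A)

/-- Van Hove sequences: exhausting sequences of relatively compact sets whose `K`-boundaries are
asymptotically negligible for every compact `K`. -/
structure IsVanHove [MeasurableSpace T] (μ : Measure T) (A : ℕ → Set T) : Prop where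
  measurableSet : ∀ n, MeasurableSet (A n)
  relativelyCompact : ∀ n, IsCompact (closure (A n))
  closure_subset : ∀ n, closure (A n) ⊆ A (n + 1)
  exhausting : ⋃ n, A n = univ
  boundary : ∀ K : Set T, IsCompact K →
    Tendsto (fun n => μ (vanHoveBoundary K (A n)) / μ (A n)) atTop (𝓝 0)

/-- `S` spans `C` up to `ε` along `F`, for the action `φ` and the distance `d`: every point of `C`
is followed by some point of `S` within `ε` for all times in `F`. -/
def IsSpanning {X : Type*} (d : X → X → ℝ) (φ : T → X → X) (F : Set T) (ε : ℝ)
    (C S : Set X) : Prop :=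
  ∀ ζ ∈ C, ∃ ξ ∈ S, ∀ s ∈ F, d (φ s ζ) (φ s ξ) < ε

/-- The minimal cardinality of a subset of the phase space `Y` that spans `C`. -/
def spanNumber {X : Type*} (d : X → X → ℝ) (φ : T → X → X) (Y : Set X) (F : Set T) (ε : ℝ)
    (C : Set X) : ℕ∞ :=
  ⨅ (S : Set X) (_ : S ⊆ Y ∧ IsSpanning d φ F ε C S), S.encard

/-- The exponential growth rate of the spanning numbers at scale `ε`. -/
def entropyAtScale [MeasurableSpace T] (μ : Measure T) {X : Type*} (d : X → X → ℝ)
    (φ : T → X → X) (Y : Set X) (A : ℕ → Set T) (ε : ℝ) (C : Set X) : EReal :=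
  limsup (fun n => ENNReal.log ((spanNumber d φ Y (A n) ε C : ℕ∞) : ℝ≥0∞) /
    ((μ (A n) : ℝ≥0∞) : EReal)) atTop

/-- The topological entropy on `C` of the action `φ` on the phase space `Y`. The rate at scale `ε`
increases as `ε` decreases, so its limit as `ε → 0` is the supremum over all `ε > 0`. -/
def entropyOn [MeasurableSpace T] (μ : Measure T) {X : Type*} (d : X → X → ℝ)
    (φ : T → X → X) (Y : Set X) (A : ℕ → Set T) (C : Set X) : EReal :=
  ⨆ (ε : ℝ) (_ : 0 < ε), entropyAtScale μ d φ Y A ε C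

end Entropy

/-! ### Delone sets, their distance, the translation action, and hulls -/

section Delone

variable {G : Type*} [NormedAddCommGroup G]

/-- Uniformly discrete and relatively dense sets. -/
def IsDelone (Γ : Set G) : Prop :=
  (∃ r > 0, ∀ g ∈ Γ, ∀ h ∈ Γ, g ≠ h → r < dist g h) ∧
    ∃ R > 0, ∀ g : G, (Γ ∩ Metric.ball g R).Nonempty

/-- The translation action: `shift g Γ = Γ - g`. -/
def shift (g : G) (Γ : Set G) : Set G := {x | x + g ∈ Γ}

/-- The distance of Delone sets, that is, the minimum of `1 / √2` and of the infimum of all `ε > 0`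
such that `Γ - δ` and `Γ'` coincide on the ball of radius `1 / ε` for some `δ` in the ball of
radius `ε`. -/
def deloneDist (Γ Γ' : Set G) : ℝ :=
  sInf (insert (1 / √2) {ε : ℝ | 0 < ε ∧ ∃ δ ∈ Metric.ball (0 : G) ε,
    shift δ Γ ∩ Metric.ball 0 (1 / ε) = Γ' ∩ Metric.ball 0 (1 / ε)})

/-- The dynamical hull: the closure, among Delone sets, of the set of translates of `Γ`. -/
def hull (Γ : Set G) : Set (Set G) :=
  {Γ' | IsDelone Γ' ∧ ∀ ε > 0, ∃ g : G, deloneDist (shift g Γ) Γ' < ε}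

/-- The translation action on the hull of `Γ` is minimal: every orbit is dense. -/
def IsMinimalHull (Γ : Set G) : Prop :=
  ∀ Γ' ∈ hull Γ, ∀ Γ'' ∈ hull Γ, ∀ ε > 0, ∃ g : G, deloneDist (shift g Γ') Γ'' < ε

/-- The topological entropy, on a subset `C` of the hull of `Γ`, of the translation action
on this hull. -/
def hullEntropyOn [MeasureSpace G] (A : ℕ → Set G) (Γ : Set G) (C : Set (Set G)) : EReal :=
  entropyOn volume deloneDist shift (hull Γ) A C

/-- The topological entropy of the translation action on the hull of `Γ`. -/
def hullEntropy [MeasureSpace G] (A : ℕ → Set G) (Γ : Set G) : EReal :=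
  hullEntropyOn A Γ (hull Γ)

end Delone

/-! ### Cut and project schemes -/

/-- `(G, H, L)` is a cut and project scheme: `L` is a discrete co-compact subgroup of `G × H` on
which the projection to `G` is injective and whose projection to `H` is dense. -/
structure IsCutAndProjectScheme {G H : Type*} [AddCommGroup G] [TopologicalSpace G]
    [AddCommGroup H] [TopologicalSpace H] (L : AddSubgroup (G × H)) : Prop where
  discrete : DiscreteTopology L
  cocompact : CompactSpace ((G × H) ⧸ L)
  injOn : InjOn Prod.fst (L : Set (G × H))
  dense : Dense (Prod.snd '' (L : Set (G × H)))

/-- The point set cut out by the window `W`. -/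
def modelSet {G H : Type*} [AddCommGroup G] [AddCommGroup H] (L : AddSubgroup (G × H))
    (W : Set H) : Set G :=
  {g | ∃ h ∈ W, (g, h) ∈ L}

/-- Proper windows: (non-empty) compact sets that are the closure of their interior. -/
structure IsProperWindow {H : Type*} [TopologicalSpace H] (W : Set H) : Prop where
  nonempty : W.Nonempty
  isCompact : IsCompact W
  closure_interior : closure (interior W) = W

/-- The torus parametrisation: the factor map `β` from the hull of the model set to the torus
`(G × H) ⧸ L`, on which `G` acts by `u • [s, t] = [s + u, t]`, with `β` of the model set itself
equal to `[0, 0]`. Only the values of `β` on the hull matter. -/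
structure IsTorusParametrisation {G H : Type*} [NormedAddCommGroup G] [AddCommGroup H]
    [TopologicalSpace H] (L : AddSubgroup (G × H)) (W : Set H)
    (β : Set G → (G × H) ⧸ L) : Prop where
  base : β (modelSet L W) = 0
  equivariant : ∀ Γ ∈ hull (modelSet L W), ∀ u : G,
    β (shift u Γ) = β Γ + QuotientAddGroup.mk (u, 0)
  continuous : ∀ Γ ∈ hull (modelSet L W), ∀ U ∈ 𝓝 (β Γ), ∃ ε > 0,
    ∀ Γ' ∈ hull (modelSet L W), deloneDist Γ Γ' < ε → β Γ' ∈ U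
  surjective : ∀ ξ, ∃ Γ ∈ hull (modelSet L W), β Γ = ξ

/-- The subgroup `A(ℤ^{N+1})` of `ℝ^N × ℝ`, generated by the columns of `A`. The first `N` rows
of `A` give the component in `ℝ^N` and the last row gives the component in `ℝ`. -/
def matrixLattice {N : ℕ} (A : Matrix (Fin (N + 1)) (Fin (N + 1)) ℝ) :
    AddSubgroup (EuclideanSpace ℝ (Fin N) × ℝ) :=
  AddSubgroup.closure (range fun j : Fin (N + 1) =>
    ((WithLp.toLp 2 fun k : Fin N => A k.castSucc j : EuclideanSpace ℝ (Fin N)),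
      A (Fin.last N) j))

/-- The subgroup `A_i(ℤ^2)` of `ℝ × ℝ`, where `A_i` is the `2 × 2` submatrix of `A` formed by
the rows `i` and `N + 1` and the columns `i` and `N + 1`. -/
def planarLattice {N : ℕ} (A : Matrix (Fin (N + 1)) (Fin (N + 1)) ℝ) (i : Fin N) :
    AddSubgroup (ℝ × ℝ) :=
  AddSubgroup.closure
    {(A i.castSucc i.castSucc, A (Fin.last N) i.castSucc),
      (A i.castSucc (Fin.last N), A (Fin.last N) (Fin.last N))}

end CutProject

end

/-! The whole hull has zero entropy, so each fibre does too; the fibres enter only through being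
non-empty, which keeps their entropy from dropping below zero. By minimality, every element of the
hull agrees locally with translates of one generic model set. Up to a bounded number of small
displacements, its behaviour along `F n` is recorded by the pattern that a window `W + τ`, with `τ`
bounded, cuts out of the finite set `X` of lattice points over a neighbourhood of `F n`
(`exists_spanNumber_le_mul_card`). A pattern depends only on the internal coordinates, and
translating by a lattice point `y` merely replaces `τ` by `τ - y.2`. The planar lattice shares its
internal coordinates with lattice points of `L`. Zero entropy of the planar model set therefore
yields a finite `T ⊆ L` on which generic windows cut out at most `M` patterns, with `log M` at most
a small multiple of `T.card` (`exists_finset_card_traces_le`). Every point of `X` lies in `T.card`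
of the translates `y + T`, `y ∈ X - T`, so Shearer's inequality bounds the number of patterns on `X`
by `M ^ ((X - T).card / T.card)` (`card_patterns_pow_le`). As `(X - T).card` is at most a constant
times the volume of `F n`, the growth rate is arbitrarily small (`hullEntropy_le_zero`). How `T` is
spread out in the physical space is irrelevant, because `T` is fixed before `n` grows. The torus
parametrisation sends `Γ` to the class of any `p` for which `Γ`, moved by `p.1`, has its points lift
to `L` with internal coordinates in `W + p.2`. Such `p` exist by compactness of the torus, and
minimality together with compactness of `W` makes the class unique. -/

namespace CutProject

/-! ### Shearer's inequality for traces -/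

/-- A superadditivity property of geometric means. -/
theorem add_pow_le_prod_of_pow_le_prod {ι : Type*} {Y Z : Finset ι} (hZY : Z ⊆ Y) {k : ℕ}
    (hk : k ≠ 0) (hZ : k ≤ Z.card) {a b : ℕ} {f g c : ι → ℕ} (ha : a ^ k ≤ ∏ y ∈ Y, f y)
    (hb : b ^ k ≤ ∏ y ∈ Y, g y) (hf : ∀ y ∈ Y, f y ≤ c y) (hg : ∀ y ∈ Y, g y ≤ c y)
    (hfg : ∀ y ∈ Z, f y + g y ≤ c y) : (a + b) ^ k ≤ ∏ y ∈ Y, c y := by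
  classical
  -- The weights `1 / k` in the AM-GM inequality require exactly `k` factors. The ratios over `Y \
  -- V` are at most one and are dropped.
  obtain ⟨V, hVZ, hVk⟩ := Finset.exists_subset_card_eq hZ
  by_cases hc : ∀ y ∈ Y, c y ≠ 0
  swap
  · push Not at hc
    obtain ⟨y, hy, hy0⟩ := hc
    have h1 : a = 0 := by
      rw [Finset.prod_eq_zero hy (by have := hf y hy; omega)] at ha
      exact pow_eq_zero_iff hk |>.1 (by omega)
    have h2 : b = 0 := by
      rw [Finset.prod_eq_zero hy (by have := hg y hy; omega)] at hb
      exact pow_eq_zero_iff hk |>.1 (by omega)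
    simp [h1, h2, hk]
  have hcpos : ∀ y ∈ Y, (0 : ℝ) < c y := fun y hy => by
    exact_mod_cast Nat.pos_of_ne_zero (hc y hy)
  have hP : (0 : ℝ) < ∏ y ∈ Y, (c y : ℝ) := Finset.prod_pos hcpos
  set D : ℝ := (∏ y ∈ Y, (c y : ℝ)) ^ ((k : ℝ)⁻¹) with hD
  have hDpos : 0 < D := Real.rpow_pos_of_pos hP _
  have hDk : D ^ k = ∏ y ∈ Y, (c y : ℝ) := Real.rpow_inv_natCast_pow hP.le hk
  have key : ∀ (x : ℕ) (e : ι → ℕ), x ^ k ≤ ∏ y ∈ Y, e y → (∀ y ∈ Y, e y ≤ c y) →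
      (x : ℝ) / D ≤ ∑ y ∈ V, (k : ℝ)⁻¹ * ((e y : ℝ) / c y) := by
    intro x e hx he
    have h1 : ((x : ℝ) / D) ^ k ≤ ∏ y ∈ V, ((e y : ℝ) / c y) := by
      rw [div_pow, hDk, div_le_iff₀ hP]
      calc (x : ℝ) ^ k ≤ ∏ y ∈ Y, (e y : ℝ) := by exact_mod_cast hx
        _ = (∏ y ∈ Y, ((e y : ℝ) / c y)) * ∏ y ∈ Y, (c y : ℝ) := by
          rw [← Finset.prod_mul_distrib]
          exact Finset.prod_congr rfl fun y hy => (div_mul_cancel₀ _ (hcpos y hy).ne').symm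
        _ ≤ _ := by
          refine mul_le_mul_of_nonneg_right ?_ hP.le
          rw [← Finset.prod_sdiff (hVZ.trans hZY)]
          refine mul_le_of_le_one_left (Finset.prod_nonneg fun y _ => by positivity) ?_
          refine Finset.prod_le_one (fun y _ => by positivity) fun y hy => ?_
          have hyY := (Finset.mem_sdiff.1 hy).1
          exact div_le_one_of_le₀ (by exact_mod_cast he y hyY) (hcpos y hyY).le
    have h2 := Real.geom_mean_le_arith_mean_weighted V (fun _ => (k : ℝ)⁻¹)
      (fun y => (e y : ℝ) / c y) (fun _ _ => by positivity)
      (by rw [Finset.sum_const, hVk, nsmul_eq_mul, mul_inv_cancel₀ (by exact_mod_cast hk)])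
      (fun _ _ => by positivity)
    refine le_trans ?_ h2
    rw [Real.finsetProd_rpow _ _ (fun _ _ => by positivity)]
    calc (x : ℝ) / D = (((x : ℝ) / D) ^ k) ^ ((k : ℝ)⁻¹) :=
          (Real.pow_rpow_inv_natCast (by positivity) hk).symm
      _ ≤ _ := Real.rpow_le_rpow (by positivity) h1 (by positivity)
  have hsum : ((a : ℝ) + b) / D ≤ 1 := by
    rw [add_div]
    calc (a : ℝ) / D + b / D
        ≤ (∑ y ∈ V, (k : ℝ)⁻¹ * ((f y : ℝ) / c y)) + ∑ y ∈ V, (k : ℝ)⁻¹ * ((g y : ℝ) / c y) :=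
          add_le_add (key a f ha hf) (key b g hb hg)
      _ = ∑ y ∈ V, (k : ℝ)⁻¹ * (((f y : ℝ) + g y) / c y) := by
          rw [← Finset.sum_add_distrib]
          exact Finset.sum_congr rfl fun y _ => by ring
      _ ≤ ∑ y ∈ V, (k : ℝ)⁻¹ * 1 := by
          refine Finset.sum_le_sum fun y hy => ?_
          refine mul_le_mul_of_nonneg_left ?_ (by positivity)
          exact div_le_one_of_le₀ (by exact_mod_cast hfg y (hVZ hy)) (by positivity)
      _ = 1 := by
          rw [Finset.sum_const, hVk, nsmul_eq_mul, mul_one, mul_inv_cancel₀ (by exact_mod_cast hk)]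
  rw [div_le_one hDpos] at hsum
  have := pow_le_pow_left₀ (by positivity) hsum k
  rw [hDk] at this
  exact_mod_cast this

/-- Shearer's inequality: if every point of `X` lies in at least `k` of the sets `T y`, then
the size of a family of subsets of `X` is controlled by the sizes of its traces on the `T y`. -/
theorem card_pow_le_prod_card_trace {α ι : Type*} [DecidableEq α] {k : ℕ} (hk : k ≠ 0)
    (Y : Finset ι) (T : ι → Finset α) (X : Finset α) (P : Finset (Finset α))
    (hP : ∀ s ∈ P, s ⊆ X) (hcov : ∀ x ∈ X, k ≤ (Y.filter fun y => x ∈ T y).card) :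
    P.card ^ k ≤ ∏ y ∈ Y, (P.image (· ∩ T y)).card := by
  induction X using Finset.induction_on generalizing P with
  | empty =>
    rcases P.eq_empty_or_nonempty with rfl | hne
    · simp [hk]
    · have h1 : P.card ≤ 1 := Finset.card_le_one.2 fun s hs t ht => by
        rw [Finset.subset_empty.1 (hP s hs), Finset.subset_empty.1 (hP t ht)]
      calc P.card ^ k ≤ 1 := pow_le_one₀ (Nat.zero_le _) h1
        _ ≤ _ := Finset.one_le_prod' fun y _ => Finset.card_pos.2 (hne.image _)
  | insert x X hx ih =>
    -- Members avoiding `x`, and members containing `x` with `x` removed, both form families of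
    -- subsets of `X`. If `x ∈ T y`, putting `x` back makes their traces on `T y` disjoint, so the
    -- trace counts add up; this happens for at least `k` indices `y`.
    have hsplit : P.card = (P.filter (x ∉ ·)).card
        + ((P.filter (x ∈ ·)).image (·.erase x)).card := by
      rw [Finset.card_image_of_injOn, add_comm, Finset.card_filter_add_card_filter_not]
      intro s hs t ht hst
      have hs' := (Finset.mem_filter.1 hs).2
      have ht' := (Finset.mem_filter.1 ht).2
      dsimp only at hst
      rw [← Finset.insert_erase hs', hst, Finset.insert_erase ht']
    have htr0 : ∀ y, (P.filter (x ∉ ·)).image (· ∩ T y) ⊆ P.image (· ∩ T y) := fun y =>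
      Finset.image_subset_image (Finset.filter_subset _ _)
    have hsum : ∀ y, x ∈ T y → ((P.filter (x ∉ ·)).image (· ∩ T y)).card
        + (((P.filter (x ∈ ·)).image (·.erase x)).image (· ∩ T y)).card
          ≤ (P.image (· ∩ T y)).card := by
      intro y hy
      have hinj : (((P.filter (x ∈ ·)).image (·.erase x)).image (· ∩ T y)).card
          = ((((P.filter (x ∈ ·)).image (·.erase x)).image (· ∩ T y)).image (insert x)).card := by
        refine (Finset.card_image_of_injOn ?_).symm
        intro s hs t ht hst
        have aux : ∀ u ∈ (((P.filter (x ∈ ·)).image (·.erase x)).image (· ∩ T y)), x ∉ u := by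
          intro u hu
          simp only [Finset.mem_image] at hu
          obtain ⟨v, ⟨w, -, rfl⟩, rfl⟩ := hu
          simp
        rw [← Finset.erase_insert (aux s hs), ← Finset.erase_insert (aux t ht)]
        exact congrArg (·.erase x) hst
      rw [hinj, ← Finset.card_union_of_disjoint]
      · refine Finset.card_le_card (Finset.union_subset (htr0 y) ?_)
        intro u hu
        simp only [Finset.mem_image, Finset.mem_filter] at hu ⊢
        obtain ⟨_, ⟨_, ⟨w, ⟨hw, hxw⟩, rfl⟩, rfl⟩, rfl⟩ := hu
        refine ⟨w, hw, ?_⟩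
        ext z
        by_cases hz : z = x
        · subst hz; simp [hxw, hy]
        · simp [hz]
      · rw [Finset.disjoint_left]
        intro u hu hu'
        simp only [Finset.mem_image, Finset.mem_filter] at hu hu'
        obtain ⟨v, ⟨-, hv⟩, rfl⟩ := hu
        obtain ⟨w, -, hw⟩ := hu'
        have : x ∈ v ∩ T y := by rw [← hw]; exact Finset.mem_insert_self _ _
        exact hv (Finset.mem_inter.1 this).1
    have hle1 : ∀ y, (((P.filter (x ∈ ·)).image (·.erase x)).image (· ∩ T y)).card
        ≤ (P.image (· ∩ T y)).card := by
      intro y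
      by_cases hy : x ∈ T y
      · have := hsum y hy; omega
      · refine Finset.card_le_card ?_
        intro u hu
        simp only [Finset.mem_image, Finset.mem_filter] at hu ⊢
        obtain ⟨_, ⟨w, ⟨hw, hxw⟩, rfl⟩, rfl⟩ := hu
        refine ⟨w, hw, ?_⟩
        ext z
        by_cases hz : z = x
        · subst hz; simp [hy]
        · simp [hz]
    have hcov' : ∀ z ∈ X, k ≤ (Y.filter fun y => z ∈ T y).card := fun z hz =>
      hcov z (Finset.mem_insert_of_mem hz)
    have ih0 := ih (P.filter (x ∉ ·)) (fun s hs z hz => by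
      rw [Finset.mem_filter] at hs
      rcases Finset.mem_insert.1 (hP s hs.1 hz) with rfl | h
      · exact absurd hz hs.2
      · exact h) hcov'
    have ih1 := ih ((P.filter (x ∈ ·)).image (·.erase x)) (fun s hs z hz => by
      simp only [Finset.mem_image, Finset.mem_filter] at hs
      obtain ⟨w, ⟨hw, -⟩, rfl⟩ := hs
      rw [Finset.mem_erase] at hz
      exact (Finset.mem_insert.1 (hP w hw hz.2)).resolve_left hz.1) hcov'
    rw [hsplit]
    refine add_pow_le_prod_of_pow_le_prod (Finset.filter_subset (fun y => x ∈ T y) Y) hk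
      (hcov x (Finset.mem_insert_self _ _)) ih0 ih1
      (fun y _ => Finset.card_le_card (htr0 y)) (fun y _ => hle1 y) ?_
    intro y hy
    exact hsum y (Finset.mem_filter.1 hy).2

end CutProject

namespace CutProject

/-! ### Lattices of cut and project schemes with internal space `ℝ` -/

section Lattice

variable {G : Type*} [NormedAddCommGroup G] {L : AddSubgroup (G × ℝ)}

theorem IsCutAndProjectScheme.isClosed (hL : IsCutAndProjectScheme L) :
    IsClosed (L : Set (G × ℝ)) :=
  have := hL.discrete
  AddSubgroup.isClosed_of_discrete

theorem IsCutAndProjectScheme.finite_inter [ProperSpace G] (hL : IsCutAndProjectScheme L)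
    {s : Set (G × ℝ)} (hs : Bornology.IsBounded s) : (s ∩ L).Finite :=
  Metric.finite_isBounded_inter_isClosed (isDiscrete_iff_discreteTopology.2 hL.discrete) hs
    hL.isClosed

theorem IsCutAndProjectScheme.eq_of_fst_eq (hL : IsCutAndProjectScheme L) {l l' : G × ℝ}
    (hl : l ∈ L) (hl' : l' ∈ L) (h : l.1 = l'.1) : l = l' :=
  hL.injOn hl hl' h

theorem IsCutAndProjectScheme.exists_norm_sub_lt (hL : IsCutAndProjectScheme L) :
    ∃ R > 0, ∀ p : G × ℝ, ∃ l ∈ L, ‖p - l‖ < R := by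
  have := hL.cocompact
  let U : ℕ → Set ((G × ℝ) ⧸ L) := fun n => QuotientAddGroup.mk '' Metric.ball (0 : G × ℝ) n
  have hU : ∀ n, IsOpen (U n) := fun n =>
    QuotientAddGroup.isOpenMap_coe _ Metric.isOpen_ball
  have hcov : (univ : Set ((G × ℝ) ⧸ L)) ⊆ ⋃ n, U n := by
    intro ξ _
    obtain ⟨p, rfl⟩ := QuotientAddGroup.mk_surjective ξ
    obtain ⟨n, hn⟩ := exists_nat_gt ‖p‖
    exact mem_iUnion.2 ⟨n, p, by simpa using hn, rfl⟩
  have hmono : Monotone U := fun m n hmn =>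
    image_mono (Metric.ball_subset_ball (by exact_mod_cast hmn))
  obtain ⟨n, hn⟩ := isCompact_univ.elim_directed_cover U hU hcov hmono.directed_le
  refine ⟨n + 1, by positivity, fun p => ?_⟩
  obtain ⟨q, hq, hqp⟩ := hn (mem_univ (QuotientAddGroup.mk p))
  refine ⟨p - q, ?_, ?_⟩
  · have := (QuotientAddGroup.eq (s := L)).1 hqp
    rwa [neg_add_eq_sub] at this
  · rw [sub_sub_cancel]
    have := mem_ball_zero_iff.1 hq
    linarith

/-- A bounded box contains finitely many lattice points, and by injectivity of the first projection
none but zero has vanishing physical coordinate. This lets closeness in `G` identify lattice points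
with bounded internal coordinates. -/
theorem IsCutAndProjectScheme.exists_separation [ProperSpace G] (hL : IsCutAndProjectScheme L)
    (C : ℝ) : ∃ r > 0, ∀ l ∈ L, ‖l.1‖ < r → |l.2| ≤ C → l = 0 := by
  have hfin : ((Metric.closedBall (0 : G) 1 ×ˢ Metric.closedBall (0 : ℝ) C) ∩ L).Finite :=
    hL.finite_inter (Metric.isBounded_closedBall.prod Metric.isBounded_closedBall)
  have h0 : ∀ᶠ r in 𝓝[>] (0 : ℝ), ∀ l ∈ (Metric.closedBall (0 : G) 1 ×ˢ
      Metric.closedBall (0 : ℝ) C) ∩ (L : Set (G × ℝ)), ‖l.1‖ < r → l = 0 := by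
    refine (eventually_all_finite hfin).2 fun l hl => ?_
    by_cases h : l = 0
    · exact Eventually.of_forall fun _ _ => h
    · have hpos : 0 < ‖l.1‖ := norm_pos_iff.2 fun h1 => h (hL.eq_of_fst_eq hl.2 L.zero_mem h1)
      filter_upwards [nhdsWithin_le_nhds (Iio_mem_nhds hpos)] with r hr hlr
      exact absurd hlr (not_lt.2 (le_of_lt hr))
  have h1 : ∀ᶠ r in 𝓝[>] (0 : ℝ), r < 1 := nhdsWithin_le_nhds (Iio_mem_nhds zero_lt_one)
  obtain ⟨r, hr, hr1, hr0⟩ := (h0.and (h1.and self_mem_nhdsWithin)).exists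
  refine ⟨r, hr0, fun l hl h1 h2 => hr l ⟨⟨?_, ?_⟩, hl⟩ h1⟩
  · simpa using h1.le.trans (le_of_lt hr1)
  · simpa using h2

/-- Co-compactness gives a lattice point near `(x, τ + w)` with `w` interior to `W`. Its internal
error lies in a compact interval, and by density finitely many lattice points suffice to correct all
such errors, which makes the radius uniform in `x` and `τ`. -/
theorem IsCutAndProjectScheme.exists_relDense (hL : IsCutAndProjectScheme L) {W : Set ℝ}
    (hW : (interior W).Nonempty) :
    ∃ R > 0, ∀ (x : G) (τ : ℝ), ∃ l ∈ L, ‖x - l.1‖ < R ∧ l.2 - τ ∈ W := by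
  obtain ⟨R, hR, hRL⟩ := hL.exists_norm_sub_lt
  obtain ⟨w, hw⟩ := hW
  have hopen : ∀ l : L, IsOpen {r : ℝ | w + ((l : G × ℝ).2 - r) ∈ interior W} := fun l =>
    isOpen_interior.preimage (by fun_prop)
  have hcov : Metric.closedBall (0 : ℝ) R ⊆
      ⋃ l : L, {r : ℝ | w + ((l : G × ℝ).2 - r) ∈ interior W} := by
    intro r _
    have ho : IsOpen {y : ℝ | w + (y - r) ∈ interior W} := isOpen_interior.preimage (by fun_prop)
    obtain ⟨_, hy, l, hl, rfl⟩ := hL.dense.inter_open_nonempty _ ho ⟨r, by simpa using hw⟩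
    exact mem_iUnion.2 ⟨⟨l, hl⟩, hy⟩
  obtain ⟨S, hS⟩ := (isCompact_closedBall (0 : ℝ) R).elim_finite_subcover _ hopen hcov
  refine ⟨R + ∑ l ∈ S, ‖(l : G × ℝ).1‖, by positivity, fun x τ => ?_⟩
  obtain ⟨p, hp, hpR⟩ := hRL (x, τ + w)
  have h1 := (norm_fst_le _).trans_lt hpR
  have h2 := (norm_snd_le _).trans_lt hpR
  simp only [Prod.fst_sub, Prod.snd_sub] at h1 h2
  have h3 := hS (show τ + w - p.2 ∈ Metric.closedBall (0 : ℝ) R by simpa using h2.le)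
  simp only [mem_iUnion] at h3
  obtain ⟨l, hlS, hl⟩ := h3
  refine ⟨p + l, L.add_mem hp l.2, ?_, interior_subset ?_⟩
  · have h4 : ‖(l : G × ℝ).1‖ ≤ ∑ l ∈ S, ‖(l : G × ℝ).1‖ :=
      Finset.single_le_sum (f := fun l : L => ‖(l : G × ℝ).1‖) (fun _ _ => norm_nonneg _) hlS
    rw [Prod.fst_add, ← sub_sub]
    exact (norm_sub_le _ _).trans_lt (add_lt_add_of_lt_of_le h1 h4)
  · convert (show w + ((l : G × ℝ).2 - (τ + w - p.2)) ∈ interior W from hl) using 1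
    simp only [Prod.snd_add]
    ring

theorem IsCutAndProjectScheme.countable [ProperSpace G] (hL : IsCutAndProjectScheme L) :
    (L : Set (G × ℝ)).Countable := by
  have : (L : Set (G × ℝ)) = ⋃ n : ℕ, Metric.ball (0 : G × ℝ) n ∩ L := by
    rw [← iUnion_inter, Metric.iUnion_ball_nat, univ_inter]
  rw [this]
  exact countable_iUnion fun n => (hL.finite_inter Metric.isBounded_ball).countable

/-- For generic translates of a closed window, no lattice point projects to the boundary. -/
theorem IsCutAndProjectScheme.exists_generic [ProperSpace G] (hL : IsCutAndProjectScheme L)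
    {W : Set ℝ} (hW : IsClosed W) : ∃ t : ℝ, ∀ l ∈ L, l.2 - t ∈ W → l.2 - t ∈ interior W := by
  have := hL.countable.to_subtype
  -- Baire category: the frontier of a closed set is closed and nowhere dense, and `L` is countable.
  have hd : Dense (⋂ l : (L : Set (G × ℝ)), {t : ℝ | (l : G × ℝ).2 - t ∉ frontier W}) := by
    refine dense_iInter_of_isOpen (fun l => ?_) fun l => ?_
    · exact isClosed_frontier.isOpen_compl.preimage (by fun_prop)
    · have h1 : Dense (frontier W)ᶜ := interior_eq_empty_iff_dense_compl.1 (interior_frontier hW)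
      exact h1.preimage (Homeomorph.subLeft (l : G × ℝ).2).isOpenMap
  obtain ⟨t, ht⟩ := hd.nonempty
  refine ⟨t, fun l hl hlt => ?_⟩
  have := mem_iInter.1 ht ⟨l, hl⟩
  rw [mem_ofPred_eq, hW.frontier_eq] at this
  by_contra h
  exact this ⟨hlt, h⟩

theorem IsProperWindow.interior_nonempty {W : Set ℝ} (hW : IsProperWindow W) :
    (interior W).Nonempty := by
  rw [← closure_nonempty_iff, hW.closure_interior]
  exact hW.nonempty

theorem IsProperWindow.exists_abs_le {W : Set ℝ} (hW : IsProperWindow W) :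
    ∃ w > 0, ∀ h ∈ W, |h| ≤ w := by
  obtain ⟨w, hw, h⟩ := hW.isCompact.isBounded.exists_pos_norm_le
  exact ⟨w, hw, h⟩

end Lattice

end CutProject

namespace CutProject

/-! ### Hulls of Delone sets -/

section Hull

variable {G : Type*} [NormedAddCommGroup G]

theorem mem_shift {g x : G} {Γ : Set G} : x ∈ shift g Γ ↔ x + g ∈ Γ := Iff.rfl

theorem shift_shift (g g' : G) (Γ : Set G) : shift g (shift g' Γ) = shift (g + g') Γ := by
  ext x
  simp only [mem_shift, add_assoc]

theorem shift_zero (Γ : Set G) : shift 0 Γ = Γ := by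
  ext x
  simp only [mem_shift, add_zero]

theorem deloneDist_lt_of_inter_eq {Γ Γ' : Set G} {ε ε' : ℝ} (h0 : 0 < ε') (h : ε' < ε) {δ : G}
    (hδ : ‖δ‖ < ε')
    (heq : shift δ Γ ∩ Metric.ball 0 (1 / ε') = Γ' ∩ Metric.ball 0 (1 / ε')) :
    deloneDist Γ Γ' < ε := by
  unfold deloneDist
  refine csInf_lt_of_lt (a := ε') ⟨0, ?_⟩ (Or.inr ⟨h0, δ, by simpa using hδ, heq⟩) h
  rintro x (rfl | hx)
  · positivity
  · exact hx.1.le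

/-- The threshold `1 / 2` is below the cap `1 / √2`, so a smaller distance comes from an actual
match. -/
theorem exists_inter_eq_of_deloneDist_lt {Γ Γ' : Set G} {ε : ℝ} (hε : ε ≤ 1 / 2)
    (h : deloneDist Γ Γ' < ε) : ∃ ε', 0 < ε' ∧ ε' < ε ∧ ∃ δ : G, ‖δ‖ < ε' ∧
      shift δ Γ ∩ Metric.ball 0 (1 / ε') = Γ' ∩ Metric.ball 0 (1 / ε') := by
  obtain ⟨ε', h', hlt⟩ := exists_lt_of_csInf_lt (insert_nonempty _ _) h
  rcases h' with rfl | ⟨h0, δ, hδ, heq⟩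
  · exfalso
    have h2 : √2 ≤ 2 := Real.sqrt_le_iff.2 ⟨by norm_num, by norm_num⟩
    have := one_div_le_one_div_of_le (by positivity) h2
    linarith
  · exact ⟨ε', h0, hlt, δ, by simpa using hδ, heq⟩

theorem inter_ball_eq_mono {Γ Γ' : Set G} {R R' : ℝ} (hR : R ≤ R')
    (h : Γ ∩ Metric.ball 0 R' = Γ' ∩ Metric.ball 0 R') :
    Γ ∩ Metric.ball 0 R = Γ' ∩ Metric.ball 0 R := by
  have := Metric.ball_subset_ball (x := (0 : G)) hR
  rw [← inter_eq_self_of_subset_right this, ← inter_assoc, ← inter_assoc, h]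

/-- Approximation by translates of `Γ` for the distance of Delone sets is the same as exact
agreement with translates of `Γ` on balls. -/
theorem forall_exists_deloneDist_shift_lt_iff {Γ Γ' : Set G} :
    (∀ ε > 0, ∃ g : G, deloneDist (shift g Γ) Γ' < ε) ↔
      ∀ R : ℝ, ∃ g : G, shift g Γ ∩ Metric.ball 0 R = Γ' ∩ Metric.ball 0 R := by
  constructor
  · intro h R
    obtain ⟨g, hg⟩ := h (min (1 / 2) (1 / max R 1)) (by positivity)
    obtain ⟨ε', h0, hlt, δ, -, heq⟩ := exists_inter_eq_of_deloneDist_lt (min_le_left _ _) hg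
    -- The small displacement is absorbed into the translation, which makes the agreement exact.
    refine ⟨δ + g, ?_⟩
    rw [shift_shift] at heq
    refine inter_ball_eq_mono ((le_max_left R 1).trans ?_) heq
    exact (le_one_div (by positivity) h0).2 (hlt.le.trans (min_le_right _ _))
  · intro h ε hε
    obtain ⟨g, hg⟩ := h (1 / (ε / 2))
    exact ⟨g, deloneDist_lt_of_inter_eq (half_pos hε) (half_lt_self hε) (δ := 0)
      (by simpa using hε) (by rwa [shift_zero])⟩

theorem mem_hull_iff {Γ Γ' : Set G} : Γ' ∈ hull Γ ↔ IsDelone Γ' ∧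
    ∀ R : ℝ, ∃ g : G, shift g Γ ∩ Metric.ball 0 R = Γ' ∩ Metric.ball 0 R :=
  and_congr_right fun _ => forall_exists_deloneDist_shift_lt_iff

theorem IsMinimalHull.exists_inter_eq {Γ Γ' Γ'' : Set G} (h : IsMinimalHull Γ)
    (h' : Γ' ∈ hull Γ) (h'' : Γ'' ∈ hull Γ) (R : ℝ) :
    ∃ g : G, shift g Γ' ∩ Metric.ball 0 R = Γ'' ∩ Metric.ball 0 R :=
  forall_exists_deloneDist_shift_lt_iff.1 (h Γ' h' Γ'' h'') R

theorem self_mem_hull {Γ : Set G} (h : IsDelone Γ) : Γ ∈ hull Γ :=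
  mem_hull_iff.2 ⟨h, fun R => ⟨0, by rw [shift_zero]⟩⟩

theorem IsDelone.shift {Γ : Set G} (h : IsDelone Γ) (u : G) : IsDelone (shift u Γ) := by
  obtain ⟨⟨r, hr, hr'⟩, R, hR, hR'⟩ := h
  refine ⟨⟨r, hr, fun g hg k hk hgk => ?_⟩, R, hR, fun g => ?_⟩
  · simpa using hr' _ hg _ hk (by simpa using hgk)
  · obtain ⟨x, hx, hxR⟩ := hR' (g + u)
    refine ⟨x - u, by simpa [mem_shift] using hx, ?_⟩
    rw [mem_ball_iff_norm] at hxR ⊢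
    rwa [sub_sub, add_comm u g]

theorem shift_mem_hull {Γ Γ' : Set G} (h : Γ' ∈ hull Γ) (u : G) : shift u Γ' ∈ hull Γ := by
  rw [mem_hull_iff] at h ⊢
  refine ⟨h.1.shift u, fun R => ?_⟩
  obtain ⟨g, hg⟩ := h.2 (R + ‖u‖)
  refine ⟨u + g, ?_⟩
  rw [← shift_shift]
  ext x
  simp only [mem_inter_iff, mem_shift, mem_ball_zero_iff]
  refine and_congr_left fun hx => ?_
  have hxu : x + u ∈ Metric.ball (0 : G) (R + ‖u‖) :=
    mem_ball_zero_iff.2 ((norm_add_le _ _).trans_lt (by linarith))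
  have := Set.ext_iff.1 hg (x + u)
  simpa only [mem_inter_iff, hxu, and_true, mem_shift] using this

end Hull

/-! ### Model sets with internal space `ℝ` -/

section ModelSet

variable {G : Type*} [NormedAddCommGroup G] [ProperSpace G] {L : AddSubgroup (G × ℝ)} {W : Set ℝ}

theorem IsCutAndProjectScheme.isDelone (hL : IsCutAndProjectScheme L) {Γ : Set G} {C R : ℝ}
    (hC : ∀ x ∈ Γ, ∃ h : ℝ, |h| ≤ C ∧ (x, h) ∈ L) (hR : 0 < R)
    (hΓ : ∀ x : G, (Γ ∩ Metric.ball x R).Nonempty) : IsDelone Γ := by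
  refine ⟨?_, R, hR, hΓ⟩
  obtain ⟨r, hr, hrL⟩ := hL.exists_separation (C + C)
  refine ⟨r / 2, half_pos hr, fun x hx y hy hxy => ?_⟩
  by_contra! hlt
  obtain ⟨h, hh, hxL⟩ := hC x hx
  obtain ⟨k, hk, hyL⟩ := hC y hy
  have := hrL _ (L.sub_mem hxL hyL) (by simpa [← dist_eq_norm] using hlt.trans_lt (half_lt_self hr))
    ((abs_sub _ _).trans (add_le_add hh hk))
  exact hxy (sub_eq_zero.1 (congrArg Prod.fst this))

/-- Every translate of the window gives rise to an element of the hull, sandwiched between the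
model sets of the interior and of the translated window. -/
theorem IsCutAndProjectScheme.exists_mem_hull (hL : IsCutAndProjectScheme L)
    (hW : IsProperWindow W) (τ : ℝ) : ∃ Γ ∈ hull (modelSet L W),
      (∀ l ∈ L, l.2 - τ ∈ interior W → l.1 ∈ Γ) ∧
        ∀ x ∈ Γ, ∃ h : ℝ, h - τ ∈ W ∧ (x, h) ∈ L := by
  obtain ⟨w, hw, hWw⟩ := hW.exists_abs_le
  obtain ⟨R₁, hR₁, hdense⟩ := hL.exists_relDense hW.interior_nonempty
  -- Shifting the model set by `l.1` with `l ∈ L` changes its window to `W - l.2`. By density `l.2`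
  -- can tend to `-τ` along `L`, and an ultrafilter provides a pointwise limit of the shifted sets.
  have hne : (comap Prod.snd (𝓝 (-τ)) ⊓ 𝓟 (L : Set (G × ℝ))).NeBot := by
    rw [inf_principal_neBot_iff]
    rintro U ⟨V, hV, hVU⟩
    obtain ⟨_, hy, l, hl, rfl⟩ := mem_closure_iff_nhds.1 (hL.dense (-τ)) V hV
    exact ⟨l, hVU hy, hl⟩
  let 𝒰 := Ultrafilter.of (comap Prod.snd (𝓝 (-τ)) ⊓ 𝓟 (L : Set (G × ℝ)))
  have h𝒰 : (𝒰 : Filter (G × ℝ)) ≤ comap Prod.snd (𝓝 (-τ)) ⊓ 𝓟 (L : Set (G × ℝ)) :=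
    Ultrafilter.of_le _
  have hlim : Tendsto (Prod.snd : G × ℝ → ℝ) 𝒰 (𝓝 (-τ)) :=
    tendsto_comap.mono_left (h𝒰.trans inf_le_left)
  have hmemL : ∀ᶠ l in (𝒰 : Filter (G × ℝ)), l ∈ L :=
    h𝒰 (mem_inf_of_right (mem_principal_self _))
  have hbdd : ∀ᶠ l in (𝒰 : Filter (G × ℝ)), |l.2| ≤ |τ| + 1 := by
    filter_upwards [hlim (Metric.ball_mem_nhds _ one_pos)] with l hl
    have h1 : |l.2 + τ| < 1 := by simpa [Real.dist_eq] using hl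
    have := abs_sub_abs_le_abs_sub l.2 (-τ)
    rw [abs_neg, sub_neg_eq_add] at this
    linarith
  let Γ : Set G := {x | ∀ᶠ l in (𝒰 : Filter (G × ℝ)), x ∈ shift l.1 (modelSet L W)}
  have hstar : ∀ l ∈ L, |l.2| ≤ |τ| + 1 → ∀ x ∈ shift l.1 (modelSet L W),
      ∃ h : ℝ, h + l.2 ∈ W ∧ |h| ≤ w + (|τ| + 1) ∧ (x, h) ∈ L := by
    rintro l hl hl1 x ⟨h, hh, hxh⟩
    have hsub : (x, h - l.2) = (x + l.1, h) - l := Prod.ext (by simp) rfl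
    refine ⟨h - l.2, by simpa using hh, ?_, hsub ▸ L.sub_mem hxh hl⟩
    exact (abs_sub _ _).trans (add_le_add (hWw h hh) hl1)
  have hupper : ∀ x ∈ Γ, ∃ h : ℝ, h - τ ∈ W ∧ |h| ≤ w + (|τ| + 1) ∧ (x, h) ∈ L := by
    intro x hx
    have hx' : ∀ᶠ l in (𝒰 : Filter (G × ℝ)), x ∈ shift l.1 (modelSet L W) := hx
    obtain ⟨l₀, hxl, hl₀, hl1⟩ := (hx'.and (hmemL.and hbdd)).exists
    obtain ⟨h, -, hh, hxh⟩ := hstar l₀ hl₀ hl1 x hxl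
    refine ⟨h, ?_, hh, hxh⟩
    have hev : ∀ᶠ l in (𝒰 : Filter (G × ℝ)), h + l.2 ∈ W := by
      filter_upwards [hx', hmemL, hbdd] with l hxl hl hl1
      obtain ⟨h', hh', -, hxh'⟩ := hstar l hl hl1 x hxl
      have : h' = h := congrArg Prod.snd (hL.eq_of_fst_eq hxh' hxh rfl)
      rwa [← this]
    have := hW.isCompact.isClosed.mem_of_tendsto (hlim.const_add h) hev
    rwa [← sub_eq_add_neg] at this
  -- Only finitely many points of a ball can occur in any of these sets, so pointwise convergence
  -- becomes equality on the ball.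
  have hlocal : ∀ R : ℝ, ∀ᶠ l in (𝒰 : Filter (G × ℝ)), l ∈ L ∧
      shift l.1 (modelSet L W) ∩ Metric.ball 0 R = Γ ∩ Metric.ball 0 R := by
    intro R
    have hfin : (Prod.fst '' ((Metric.ball (0 : G) R ×ˢ
        Metric.closedBall (0 : ℝ) (w + (|τ| + 1))) ∩ L)).Finite :=
      (hL.finite_inter (Metric.isBounded_ball.prod Metric.isBounded_closedBall)).image _
    have hev : ∀ᶠ l in (𝒰 : Filter (G × ℝ)), ∀ x ∈ Prod.fst '' ((Metric.ball (0 : G) R ×ˢ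
        Metric.closedBall (0 : ℝ) (w + (|τ| + 1))) ∩ L),
          (x ∈ shift l.1 (modelSet L W) ↔ x ∈ Γ) := by
      refine (eventually_all_finite hfin).2 fun x _ => ?_
      by_cases hx : x ∈ Γ
      · have hx' : ∀ᶠ l in (𝒰 : Filter (G × ℝ)), x ∈ shift l.1 (modelSet L W) := hx
        filter_upwards [hx'] with l hl
        simp [hl, hx]
      · have hx' : ∀ᶠ l in (𝒰 : Filter (G × ℝ)), x ∉ shift l.1 (modelSet L W) :=
          Ultrafilter.eventually_not.2 hx
        filter_upwards [hx'] with l hl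
        simp [hl, hx]
    filter_upwards [hev, hmemL, hbdd] with l hl hlL hl1
    refine ⟨hlL, ?_⟩
    ext x
    refine and_congr_left fun hxR => ⟨fun hx => ?_, fun hx => ?_⟩
    · obtain ⟨h, -, hh, hxh⟩ := hstar l hlL hl1 x hx
      exact (hl x ⟨(x, h), ⟨⟨hxR, by simpa using hh⟩, hxh⟩, rfl⟩).1 hx
    · obtain ⟨h, -, hh, hxh⟩ := hupper x hx
      exact (hl x ⟨(x, h), ⟨⟨hxR, by simpa using hh⟩, hxh⟩, rfl⟩).2 hx
  have hdel : IsDelone Γ := by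
    refine hL.isDelone (C := w + (|τ| + 1)) (fun x hx => ?_) hR₁ fun x => ?_
    · obtain ⟨h, -, hh⟩ := hupper x hx
      exact ⟨h, hh⟩
    · obtain ⟨l, hl, heq⟩ := (hlocal (‖x‖ + R₁)).exists
      obtain ⟨p, hp, hpx, hpW⟩ := hdense (x + l.1) 0
      have hball : p.1 - l.1 ∈ Metric.ball x R₁ := by
        rw [mem_ball_iff_norm', ← sub_add, sub_add_eq_add_sub]
        exact hpx
      refine ⟨p.1 - l.1, ?_, hball⟩
      have : p.1 - l.1 ∈ shift l.1 (modelSet L W) ∩ Metric.ball 0 (‖x‖ + R₁) := by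
        refine ⟨?_, ?_⟩
        · rw [mem_shift, sub_add_cancel]
          exact ⟨p.2, by simpa using hpW, hp⟩
        · rw [mem_ball_zero_iff]
          rw [mem_ball_iff_norm] at hball
          calc ‖p.1 - l.1‖ = ‖x + (p.1 - l.1 - x)‖ := by rw [add_sub_cancel]
            _ ≤ _ := norm_add_le _ _
            _ < _ := by linarith
      rw [heq] at this
      exact this.1
  refine ⟨Γ, mem_hull_iff.2 ⟨hdel, fun R => ?_⟩, fun l hl hlW => ?_, fun x hx => ?_⟩
  · obtain ⟨l, -, hl⟩ := (hlocal R).exists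
    exact ⟨l.1, hl⟩
  · have h1 : ∀ᶠ p in (𝒰 : Filter (G × ℝ)), l.2 + p.2 ∈ interior W := by
      refine (hlim.const_add l.2).eventually_mem (isOpen_interior.mem_nhds ?_)
      rwa [← sub_eq_add_neg]
    have h2 : ∀ᶠ p in (𝒰 : Filter (G × ℝ)), l.1 ∈ shift p.1 (modelSet L W) := by
      filter_upwards [h1, hmemL] with p hp hpL
      exact ⟨l.2 + p.2, interior_subset hp, L.add_mem hl hpL⟩
    exact h2
  · obtain ⟨h, hh, -, hxh⟩ := hupper x hx
    exact ⟨h, hh, hxh⟩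

/-- A generic translate of the window gives rise to an element of the hull. -/
theorem IsCutAndProjectScheme.modelSet_mem_hull (hL : IsCutAndProjectScheme L)
    (hW : IsProperWindow W) {τ : ℝ} (hτ : ∀ l ∈ L, l.2 - τ ∈ W → l.2 - τ ∈ interior W) :
    modelSet L {h | h - τ ∈ W} ∈ hull (modelSet L W) := by
  obtain ⟨Γ, hΓ, h1, h2⟩ := hL.exists_mem_hull hW τ
  convert hΓ using 1
  ext x
  constructor
  · rintro ⟨h, hh, hxh⟩
    exact h1 _ hxh (hτ _ hxh hh)
  · exact h2 x

theorem IsCutAndProjectScheme.isDelone_modelSet (hL : IsCutAndProjectScheme L)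
    (hW : IsProperWindow W) : IsDelone (modelSet L W) := by
  obtain ⟨w, -, hWw⟩ := hW.exists_abs_le
  obtain ⟨R, hR, hdense⟩ := hL.exists_relDense hW.interior_nonempty
  refine hL.isDelone (C := w) (fun x ⟨h, hh, hxh⟩ => ⟨h, hWw h hh, hxh⟩) hR fun x => ?_
  obtain ⟨l, hl, hlx, hlW⟩ := hdense x 0
  exact ⟨l.1, ⟨l.2, by simpa using hlW, hl⟩, by rwa [mem_ball_iff_norm']⟩

end ModelSet

end CutProject

namespace CutProject

/-! ### Existence of the torus parametrisation -/

section Torus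

variable {G : Type*} [NormedAddCommGroup G] {L : AddSubgroup (G × ℝ)} {W : Set ℝ}

/-- `Γ` is contained in the model set of the window `W + p.2`, translated by `-p.1`. -/
def IsBelow (L : AddSubgroup (G × ℝ)) (W : Set ℝ) (Γ : Set G) (p : G × ℝ) : Prop :=
  ∀ x ∈ Γ, ∃ h ∈ W, (x + p.1, h + p.2) ∈ L

theorem IsBelow.sub_mem {Γ : Set G} {p l : G × ℝ} (h : IsBelow L W Γ p) (hl : l ∈ L) :
    IsBelow L W Γ (p - l) := by
  intro x hx
  obtain ⟨k, hk, hkL⟩ := h x hx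
  refine ⟨k, hk, ?_⟩
  have : (x + (p - l).1, k + (p - l).2) = (x + p.1, k + p.2) - l :=
    Prod.ext (add_sub_assoc _ _ _).symm (add_sub_assoc _ _ _).symm
  rw [this]
  exact L.sub_mem hkL hl

theorem IsBelow.shift {Γ : Set G} {p : G × ℝ} (h : IsBelow L W Γ p) (u : G) :
    IsBelow L W (shift u Γ) (p + (u, 0)) := by
  intro x hx
  obtain ⟨k, hk, hkL⟩ := h _ hx
  refine ⟨k, hk, ?_⟩
  convert hkL using 2
  · simp only [Prod.fst_add]; abel
  · simp

theorem isBelow_modelSet : IsBelow L W (modelSet L W) 0 := by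
  rintro x ⟨h, hh, hxh⟩
  exact ⟨h, hh, by simpa using hxh⟩

/-- The condition at `x` says that `(x + p.1, p.2)` lies in `L - {0} × W`, which is closed as the
difference of a closed and a compact set. -/
theorem IsBelow.of_tendsto (hL : IsCutAndProjectScheme L) (hW : IsCompact W) {Γ : Set G}
    {p : G × ℝ} {Γs : ℕ → Set G} {ps : ℕ → G × ℝ}
    (hΓ : ∀ x ∈ Γ, ∀ η > 0, ∀ᶠ n in atTop, ∃ y ∈ Γs n, dist y x < η)
    (hs : ∀ n, IsBelow L W (Γs n) (ps n)) (hp : Tendsto ps atTop (𝓝 p)) : IsBelow L W Γ p := by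
  have hcl : IsClosed ((L : Set (G × ℝ)) - ({0} : Set G) ×ˢ W) := by
    rw [sub_eq_add_neg]
    exact hL.isClosed.add_right_of_isCompact (isCompact_singleton.prod hW).neg
  have hmem : ∀ q : G × ℝ, q ∈ (L : Set (G × ℝ)) - ({0} : Set G) ×ˢ W ↔
      ∃ h ∈ W, (q.1, h + q.2) ∈ L := by
    intro q
    constructor
    · rintro ⟨l, hl, ⟨a, h⟩, ⟨ha, hh⟩, rfl⟩
      obtain rfl : a = 0 := ha
      exact ⟨h, hh, by simpa using hl⟩
    · rintro ⟨h, hh, hq⟩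
      exact ⟨_, hq, (0, h), ⟨rfl, hh⟩, Prod.ext (sub_zero _) (add_sub_cancel_left _ _)⟩
  intro x hx
  refine (hmem (x + p.1, p.2)).1 (hcl.closure_subset ?_)
  rw [Metric.mem_closure_iff]
  intro η hη
  have h2 : ∀ᶠ n in atTop, dist (ps n) p < η / 2 := hp (Metric.ball_mem_nhds _ (half_pos hη))
  obtain ⟨n, ⟨y, hy, hyx⟩, hn⟩ := ((hΓ x hx (η / 2) (half_pos hη)).and h2).exists
  refine ⟨(y + (ps n).1, (ps n).2), (hmem _).2 (hs n y hy), ?_⟩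
  rw [Prod.dist_eq, max_lt_iff] at hn ⊢
  refine ⟨?_, ?_⟩
  · rw [dist_comm]
    exact (dist_add_add_le _ _ _ _).trans_lt (by linarith [hn.1])
  · rw [dist_comm]
    exact hn.2.trans (half_lt_self hη)

theorem IsCutAndProjectScheme.exists_tendsto_sub [ProperSpace G] (hL : IsCutAndProjectScheme L)
    (p : ℕ → G × ℝ) : ∃ l : ℕ → G × ℝ, (∀ n, l n ∈ L) ∧ ∃ (q : G × ℝ) (k : ℕ → ℕ),
      StrictMono k ∧ Tendsto (fun n => p (k n) - l (k n)) atTop (𝓝 q) := by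
  obtain ⟨R, hR, hRL⟩ := hL.exists_norm_sub_lt
  choose l hl hlR using fun n => hRL (p n)
  obtain ⟨q, -, k, hk, hq⟩ := (isCompact_closedBall (0 : G × ℝ) R).tendsto_subseq
    (x := fun n => p n - l n) (fun n => mem_closedBall_zero_iff.2 (hlR n).le)
  exact ⟨l, hl, q, k, hk, hq⟩

/-- One point of the model set produces `m ∈ L` with `m.1 = p.1`. By density and properness, `W +
(m.2 - p.2) ⊆ W`; a compact set admits no non-trivial translation into itself, so `p = m`. -/
theorem IsBelow.mem_of_modelSet (hL : IsCutAndProjectScheme L) (hW : IsProperWindow W)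
    {p : G × ℝ} (h : IsBelow L W (modelSet L W) p) : p ∈ L := by
  obtain ⟨_, hl₀, l₀, hl₀L, rfl⟩ :=
    hL.dense.inter_open_nonempty _ isOpen_interior hW.interior_nonempty
  obtain ⟨k, hk, hkL⟩ := h l₀.1 ⟨l₀.2, interior_subset hl₀, hl₀L⟩
  set m := (l₀.1 + p.1, k + p.2) - l₀ with hm
  have hmL : m ∈ L := L.sub_mem hkL hl₀L
  have hm1 : m.1 = p.1 := by simp [hm]
  have hsub : W ⊆ (fun y => y + (m.2 - p.2)) ⁻¹' W := by
    have hcl : IsClosed ((fun y => y + (m.2 - p.2)) ⁻¹' W) :=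
      hW.isCompact.isClosed.preimage (by fun_prop)
    have h1 : interior W ⊆ closure (interior W ∩ Prod.snd '' (L : Set (G × ℝ))) :=
      hL.dense.open_subset_closure_inter isOpen_interior
    have h2 : interior W ∩ Prod.snd '' (L : Set (G × ℝ)) ⊆
        (fun y => y + (m.2 - p.2)) ⁻¹' W := by
      rintro _ ⟨hl, l, hlL, rfl⟩
      obtain ⟨k', hk', hkL'⟩ := h l.1 ⟨l.2, interior_subset hl, hlL⟩
      have := congrArg Prod.snd (hL.eq_of_fst_eq hkL' (L.add_mem hlL hmL) (by simp [hm1]))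
      simp only [Prod.snd_add] at this
      have h3 : l.2 + (m.2 - p.2) = k' := by linarith
      rw [mem_preimage, h3]
      exact hk'
    have h3 := closure_minimal (h1.trans (closure_minimal h2 hcl)) hcl
    rwa [hW.closure_interior] at h3
  obtain ⟨M, hMW, hM⟩ := hW.isCompact.exists_isGreatest hW.nonempty
  obtain ⟨M', hMW', hM'⟩ := hW.isCompact.exists_isLeast hW.nonempty
  have h1 : M + (m.2 - p.2) ≤ M := hM (hsub hMW)
  have h2 : M' ≤ M' + (m.2 - p.2) := hM' (hsub hMW')
  have : p = m := Prod.ext hm1.symm (by linarith)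
  rwa [this]

variable [ProperSpace G]

/-- The translates approximating `Γ` lie below `(g n, 0)`. Modulo `L` these points subconverge, and
the relation passes to the limit. -/
theorem exists_isBelow (hL : IsCutAndProjectScheme L) (hW : IsProperWindow W) {Γ : Set G}
    (hΓ : Γ ∈ hull (modelSet L W)) : ∃ p, IsBelow L W Γ p := by
  choose g hg using fun n : ℕ => (mem_hull_iff.1 hΓ).2 n
  obtain ⟨l, hl, q, k, hk, hq⟩ := hL.exists_tendsto_sub (fun n => (0 : G × ℝ) + (g n, 0))
  refine ⟨q, IsBelow.of_tendsto hL hW.isCompact (Γs := fun n => shift (g (k n)) (modelSet L W))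
    (fun x hx η hη => ?_) (fun n => (isBelow_modelSet.shift _).sub_mem (hl _)) hq⟩
  obtain ⟨N, hN⟩ := exists_nat_gt ‖x‖
  filter_upwards [eventually_ge_atTop N] with n hn
  have hx' : x ∈ Γ ∩ Metric.ball 0 (k n : ℝ) := ⟨hx, mem_ball_zero_iff.2
    (hN.trans_le (by exact_mod_cast hn.trans (hk.id_le n)))⟩
  rw [← hg] at hx'
  exact ⟨x, hx'.1, by simpa using hη⟩

/-- Minimality allows translating `Γ` back towards the model set itself. The translations move `p`
and `p'` alike, so the limits differ by `p' - p`, and both limits lie in `L` by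
`IsBelow.mem_of_modelSet`. -/
theorem IsBelow.sub_mem_of_isMinimalHull (hL : IsCutAndProjectScheme L) (hW : IsProperWindow W)
    (hmin : IsMinimalHull (modelSet L W)) {Γ : Set G} (hΓ : Γ ∈ hull (modelSet L W))
    {p p' : G × ℝ} (h : IsBelow L W Γ p) (h' : IsBelow L W Γ p') : p' - p ∈ L := by
  have hself := self_mem_hull (hL.isDelone_modelSet hW)
  choose g hg using fun n : ℕ => hmin.exists_inter_eq hΓ hself n
  obtain ⟨l, hl, q, k, hk, hq⟩ := hL.exists_tendsto_sub (fun n => p + (g n, 0))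
  have hlim : ∀ x ∈ modelSet L W, ∀ η > 0, ∀ᶠ n in atTop,
      ∃ y ∈ CutProject.shift (g (k n)) Γ, dist y x < η := by
    intro x hx η hη
    obtain ⟨N, hN⟩ := exists_nat_gt ‖x‖
    filter_upwards [eventually_ge_atTop N] with n hn
    have hx' : x ∈ modelSet L W ∩ Metric.ball 0 (k n : ℝ) := ⟨hx, mem_ball_zero_iff.2
      (hN.trans_le (by exact_mod_cast hn.trans (hk.id_le n)))⟩
    rw [← hg] at hx'
    exact ⟨x, hx'.1, by simpa using hη⟩
  have h1 : IsBelow L W (modelSet L W) q := IsBelow.of_tendsto hL hW.isCompact hlim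
    (fun n => (h.shift _).sub_mem (hl _)) hq
  have h2 : IsBelow L W (modelSet L W) (q + (p' - p)) := by
    refine IsBelow.of_tendsto hL hW.isCompact hlim
      (fun n => (h'.shift _).sub_mem (hl (k n))) ((hq.add_const (p' - p)).congr fun n => ?_)
    abel
  have := L.sub_mem (h2.mem_of_modelSet hL hW) (h1.mem_of_modelSet hL hW)
  rwa [add_sub_cancel_left] at this

open Classical in
/-- The class `[p]` of any `p` such that `Γ` lies below the model set translated by `p`. -/
noncomputable def torusMap (L : AddSubgroup (G × ℝ)) (W : Set ℝ) (Γ : Set G) : (G × ℝ) ⧸ L :=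
  if h : ∃ p, IsBelow L W Γ p then QuotientAddGroup.mk h.choose else 0

theorem IsBelow.torusMap_eq (hL : IsCutAndProjectScheme L) (hW : IsProperWindow W)
    (hmin : IsMinimalHull (modelSet L W)) {Γ : Set G} (hΓ : Γ ∈ hull (modelSet L W))
    {p : G × ℝ} (h : IsBelow L W Γ p) : torusMap L W Γ = QuotientAddGroup.mk p := by
  have hex : ∃ p, IsBelow L W Γ p := ⟨p, h⟩
  rw [torusMap, dif_pos hex, QuotientAddGroup.eq, neg_add_eq_sub]
  exact IsBelow.sub_mem_of_isMinimalHull hL hW hmin hΓ hex.choose_spec h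

/-- The torus parametrisation exists for proper windows in `ℝ` giving a minimal hull. -/
theorem isTorusParametrisation_torusMap (hL : IsCutAndProjectScheme L) (hW : IsProperWindow W)
    (hmin : IsMinimalHull (modelSet L W)) : IsTorusParametrisation L W (torusMap L W) where
  base := isBelow_modelSet.torusMap_eq hL hW hmin (self_mem_hull (hL.isDelone_modelSet hW))
  equivariant Γ hΓ u := by
    obtain ⟨p, hp⟩ := exists_isBelow hL hW hΓ
    rw [hp.torusMap_eq hL hW hmin hΓ, (hp.shift u).torusMap_eq hL hW hmin (shift_mem_hull hΓ u)]
    rfl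
  continuous Γ hΓ U hU := by
    by_contra! hcon
    -- The shift by 2 keeps the scale at most `1 / 2`, out of reach of the cap in `deloneDist`.
    choose Γs hs hd hU' using fun n : ℕ => hcon (1 / ((n : ℝ) + 2)) (by positivity)
    choose p hp using fun n => exists_isBelow hL hW (hs n)
    obtain ⟨l, hl, q, k, hk, hq⟩ := hL.exists_tendsto_sub p
    have hlim : ∀ x ∈ Γ, ∀ η > 0, ∀ᶠ n in atTop, ∃ y ∈ Γs (k n), dist y x < η := by
      intro x hx η hη
      obtain ⟨N, hN⟩ := exists_nat_gt (max (1 / η) (‖x‖ + 1))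
      filter_upwards [eventually_ge_atTop N] with n hn
      have hNk : (N : ℝ) ≤ k n := by exact_mod_cast hn.trans (hk.id_le n)
      have hk0 : (0 : ℝ) ≤ k n := Nat.cast_nonneg _
      have hle : 1 / ((k n : ℝ) + 2) ≤ 1 / 2 := one_div_le_one_div_of_le two_pos (by linarith)
      obtain ⟨ε', h0, hlt, δ, hδ, heq⟩ := exists_inter_eq_of_deloneDist_lt hle (hd (k n))
      have hmem : x - δ ∈ shift δ Γ ∩ Metric.ball 0 (1 / ε') := by
        refine ⟨by simpa [mem_shift] using hx, mem_ball_zero_iff.2 ?_⟩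
        have h1 : (k n : ℝ) + 2 < 1 / ε' := (lt_one_div h0 (by positivity)).1 hlt
        have h2 := le_max_right (1 / η) (‖x‖ + 1)
        have h3 := norm_sub_le x δ
        linarith
      rw [heq] at hmem
      refine ⟨x - δ, hmem.1, ?_⟩
      rw [dist_eq_norm, sub_sub_cancel_left, norm_neg]
      refine hδ.trans (hlt.trans ?_)
      rw [one_div_lt (by positivity) hη]
      have h2 := le_max_left (1 / η) (‖x‖ + 1)
      linarith
    have hq' : IsBelow L W Γ q := IsBelow.of_tendsto hL hW.isCompact hlim
      (fun n => (hp (k n)).sub_mem (hl _)) hq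
    rw [hq'.torusMap_eq hL hW hmin hΓ] at hU
    have hcont : Continuous (QuotientAddGroup.mk : G × ℝ → (G × ℝ) ⧸ L) :=
      QuotientAddGroup.continuous_mk
    obtain ⟨n, hn⟩ := ((hcont.tendsto q).comp hq |>.eventually_mem hU).exists
    refine hU' (k n) ?_
    rw [((hp (k n)).sub_mem (hl (k n))).torusMap_eq hL hW hmin (hs _)]
    exact hn
  surjective ξ := by
    obtain ⟨p, rfl⟩ := QuotientAddGroup.mk_surjective ξ
    obtain ⟨Γ, hΓ, -, h⟩ := hL.exists_mem_hull hW p.2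
    have hΓ' := shift_mem_hull hΓ p.1
    refine ⟨shift p.1 Γ, hΓ', IsBelow.torusMap_eq hL hW hmin hΓ' fun x hx => ?_⟩
    obtain ⟨k, hk, hkL⟩ := h _ hx
    exact ⟨k - p.2, hk, by rwa [sub_add_cancel]⟩

end Torus

end CutProject

namespace CutProject

/-! ### Van Hove sequences and counting of lattice points -/

section VanHove

variable {G : Type*} [NormedAddCommGroup G] [MeasureSpace G] {F : ℕ → Set G}

theorem IsVanHove.volume_lt_top [IsFiniteMeasureOnCompacts (volume : Measure G)]
    (hF : IsVanHove volume F) (n : ℕ) : volume (F n) < ⊤ :=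
  (measure_mono subset_closure).trans_lt (hF.relativelyCompact n).measure_lt_top

theorem IsVanHove.isBounded (hF : IsVanHove volume F) (n : ℕ) : Bornology.IsBounded (F n) :=
  (hF.relativelyCompact n).isBounded.subset subset_closure

variable [BorelSpace G] [ProperSpace G] [NoncompactSpace G]
  [(volume : Measure G).IsAddHaarMeasure]

theorem IsVanHove.tendsto_volume (hF : IsVanHove volume F) :
    Tendsto (fun n => volume (F n)) atTop (𝓝 ⊤) := by
  have hmono : Monotone F :=
    monotone_nat_of_le_succ fun n => subset_closure.trans (hF.closure_subset n)
  have := tendsto_measure_iUnion_atTop (μ := (volume : Measure G)) hmono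
  rwa [hF.exhausting, measure_univ_of_isAddLeftInvariant] at this

theorem IsVanHove.eventually_volume_pos (hF : IsVanHove volume F) :
    ∀ᶠ n in atTop, 0 < volume (F n) :=
  hF.tendsto_volume.eventually_const_lt ENNReal.zero_lt_top

theorem IsVanHove.eventually_boundary_le (hF : IsVanHove volume F) (r : ℝ) :
    ∀ᶠ n in atTop, volume (vanHoveBoundary (Metric.closedBall 0 r) (F n)) ≤ volume (F n) / 2 := by
  have h := (hF.boundary _ (isCompact_closedBall (0 : G) r)).eventually_lt_const
    (show (0 : ℝ≥0∞) < 1 / 2 by simp)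
  filter_upwards [h, hF.eventually_volume_pos] with n hn h0
  rw [ENNReal.div_lt_iff (Or.inl h0.ne') (Or.inl (hF.volume_lt_top n).ne)] at hn
  refine hn.le.trans (le_of_eq ?_)
  rw [one_div, mul_comm, div_eq_mul_inv]

theorem IsVanHove.eventually_volume_add_le (hF : IsVanHove volume F) (r : ℝ) :
    ∀ᶠ n in atTop, volume (Metric.closedBall 0 r + F n) ≤ 2 * volume (F n) := by
  filter_upwards [hF.eventually_boundary_le r] with n hn
  have hsub : Metric.closedBall 0 r + F n ⊆
      F n ∪ vanHoveBoundary (Metric.closedBall 0 r) (F n) := by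
    intro x hx
    by_cases h : x ∈ interior (F n)
    · exact Or.inl (interior_subset h)
    · exact Or.inr (Or.inl ⟨hx, h⟩)
  calc _ ≤ _ := (measure_mono hsub).trans (measure_union_le _ _)
    _ ≤ volume (F n) + volume (F n) := by
      exact add_le_add le_rfl (hn.trans ENNReal.half_le_self)
    _ = _ := (two_mul _).symm

theorem IsVanHove.eventually_volume_le (hF : IsVanHove volume F) (r : ℝ) :
    ∀ᶠ n in atTop,
      volume (F n) ≤ 2 * volume {x | x ∈ F n ∧ Metric.closedBall x r ⊆ F n} := by
  filter_upwards [hF.eventually_boundary_le r] with n hn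
  set I := {x | x ∈ F n ∧ Metric.closedBall x r ⊆ F n}
  have hsub : F n ⊆ I ∪ vanHoveBoundary (Metric.closedBall 0 r) (F n) := by
    intro x hx
    by_cases h : Metric.closedBall x r ⊆ F n
    · exact Or.inl ⟨hx, h⟩
    · obtain ⟨y, hy, hyF⟩ := not_subset.1 h
      refine Or.inr (Or.inr ⟨⟨y, subset_closure hyF, x - y, ?_, add_sub_cancel _ _⟩, hx⟩)
      rw [mem_closedBall_zero_iff, ← dist_eq_norm, dist_comm]
      exact hy
  have h1 : volume (F n) ≤ volume I + volume (F n) / 2 :=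
    ((measure_mono hsub).trans (measure_union_le _ _)).trans (by gcongr)
  have hfin : volume (F n) / 2 ≠ ⊤ := ENNReal.div_ne_top (hF.volume_lt_top n).ne two_ne_zero
  have h2 : volume (F n) / 2 ≤ volume I := by
    have h3 : volume (F n) / 2 + volume (F n) / 2 ≤ volume I + volume (F n) / 2 := by
      rwa [ENNReal.add_halves]
    exact (ENNReal.add_le_add_iff_right hfin).1 h3
  calc volume (F n) = 2 * (volume (F n) / 2) :=
        (ENNReal.mul_div_cancel two_ne_zero ENNReal.ofNat_ne_top).symm
    _ ≤ _ := by gcongr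

end VanHove

section Counting

variable {G : Type*} [NormedAddCommGroup G] [MeasureSpace G] [BorelSpace G]
  [(volume : Measure G).IsAddHaarMeasure] {L : AddSubgroup (G × ℝ)}

/-- Packing: bounded internal coordinates keep the physical coordinates apart, so the balls around
them are disjoint. -/
theorem IsCutAndProjectScheme.exists_card_mul_le [ProperSpace G]
    (hL : IsCutAndProjectScheme L) (C : ℝ) : ∃ r > 0, ∀ (D : Set G) (S : Finset (G × ℝ)),
      (∀ l ∈ S, l ∈ L ∧ l.1 ∈ D ∧ |l.2| ≤ C) →
        S.card * volume (Metric.ball (0 : G) r) ≤ volume (Metric.closedBall 0 r + D) := by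
  obtain ⟨r, hr, hrL⟩ := hL.exists_separation (C + C)
  refine ⟨r / 2, half_pos hr, fun D S hS => ?_⟩
  have hdisj : (S : Set (G × ℝ)).PairwiseDisjoint fun l => Metric.ball l.1 (r / 2) := by
    intro l hl m hm hlm
    refine Metric.ball_disjoint_ball ?_
    by_contra! hlt
    obtain ⟨hlL, -, hl2⟩ := hS l hl
    obtain ⟨hmL, -, hm2⟩ := hS m hm
    rw [add_halves, dist_eq_norm] at hlt
    exact hlm (sub_eq_zero.1 (hrL _ (L.sub_mem hlL hmL) hlt
      ((abs_sub _ _).trans (add_le_add hl2 hm2))))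
  have hsub : ⋃ l ∈ S, Metric.ball l.1 (r / 2) ⊆ Metric.closedBall 0 (r / 2) + D := by
    refine iUnion₂_subset fun l hl x hx => ⟨x - l.1, ?_, l.1, (hS l hl).2.1, sub_add_cancel _ _⟩
    rw [mem_ball_iff_norm] at hx
    exact mem_closedBall_zero_iff.2 hx.le
  calc _ = ∑ l ∈ S, volume (Metric.ball l.1 (r / 2)) := by
        simp only [Measure.addHaar_ball_center, Finset.sum_const, nsmul_eq_mul]
    _ = _ := (measure_biUnion_finset hdisj fun _ _ => measurableSet_ball).symm
    _ ≤ _ := measure_mono hsub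

/-- Covering: a point `x` deep inside `D` is within `R` of the physical coordinate of a lattice
point chosen near `(x, 0)`. -/
theorem volume_le_card_mul {R : ℝ}
    (hR : ∀ p : G × ℝ, ∃ l ∈ L, ‖p - l‖ < R) {D : Set G} {S : Finset (G × ℝ)}
    (hS : ∀ l ∈ L, l.1 ∈ D → |l.2| ≤ R → l ∈ S) :
    volume {x | x ∈ D ∧ Metric.closedBall x R ⊆ D} ≤ S.card * volume (Metric.ball (0 : G) R) := by
  have hsub : {x | x ∈ D ∧ Metric.closedBall x R ⊆ D} ⊆ ⋃ l ∈ S, Metric.ball l.1 R := by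
    rintro x ⟨-, hx⟩
    obtain ⟨l, hl, hlR⟩ := hR (x, 0)
    have h1 : ‖x - l.1‖ < R := (norm_fst_le _).trans_lt hlR
    have h2 : ‖0 - l.2‖ < R := (norm_snd_le _).trans_lt hlR
    rw [zero_sub, norm_neg] at h2
    refine mem_iUnion₂.2 ⟨l, hS l hl (hx ?_) h2.le, by rwa [mem_ball_iff_norm]⟩
    rw [mem_closedBall_iff_norm']
    exact h1.le
  calc _ ≤ _ := (measure_mono hsub).trans (measure_biUnion_finset_le _ _)
    _ = _ := by simp only [Measure.addHaar_ball_center, Finset.sum_const, nsmul_eq_mul]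

end Counting

/-! ### Spanning numbers and patterns -/

section Patterns

theorem spanNumber_le_card {T X D : Type*} [AddCommGroup T] {d : X → X → ℝ} {φ : T → X → X}
    {Y C : Set X} {F : Set T} {ε : ℝ} (hCY : C ⊆ Y) (𝒟 : Finset D) (P : X → D → Prop)
    (hex : ∀ ζ ∈ C, ∃ a ∈ 𝒟, P ζ a)
    (hclose : ∀ ζ ∈ C, ∀ ζ' ∈ C, ∀ a, P ζ a → P ζ' a → ∀ s ∈ F, d (φ s ζ) (φ s ζ') < ε) :
    spanNumber d φ Y F ε C ≤ 𝒟.card := by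
  classical
  let E : Set D := {a | a ∈ 𝒟 ∧ ∃ ζ ∈ C, P ζ a}
  have hE : ∀ a : E, ∃ ζ ∈ C, P ζ a := fun a => a.2.2
  choose f hfC hfP using hE
  have hspan : range f ⊆ Y ∧ IsSpanning d φ F ε C (range f) := by
    refine ⟨?_, fun ζ hζ => ?_⟩
    · rintro _ ⟨a, rfl⟩
      exact hCY (hfC a)
    · obtain ⟨a, ha, hP⟩ := hex ζ hζ
      exact ⟨_, ⟨⟨a, ha, ζ, hζ, hP⟩, rfl⟩, hclose ζ hζ _ (hfC _) a hP (hfP _)⟩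
  refine (iInf₂_le (range f) hspan).trans ?_
  calc (range f).encard ≤ E.encard := by
        rw [← image_univ]
        refine (encard_image_le _ _).trans ?_
        rw [encard_univ, ENat.card_coe_set_eq]
    _ ≤ (𝒟 : Set D).encard := encard_le_encard fun a ha => ha.1
    _ = 𝒟.card := encard_coe_eq_coe_finsetCard 𝒟

variable {G : Type*} [NormedAddCommGroup G] [ProperSpace G] {L : AddSubgroup (G × ℝ)} {W : Set ℝ}

open Classical in
/-- The number of ways in which generic translates of the window meet the internal coordinates of
lattice points over `B` is at most the size of a spanning set along `B`. -/
theorem IsCutAndProjectScheme.exists_card_traces_le (hL : IsCutAndProjectScheme L)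
    (hW : IsProperWindow W) (α : Type*) (C : ℝ) : ∃ ε > 0, ∀ (B : Set G) (S : Set (Set G)),
      IsSpanning deloneDist shift B ε (hull (modelSet L W)) S →
      ∀ (T : Finset α) (f : α → ℝ), (∀ z ∈ T, ∃ x ∈ B, (x, f z) ∈ L) →
      ∀ 𝒬 : Finset (Finset α), (∀ Q ∈ 𝒬, ∃ τ : ℝ, |τ| ≤ C ∧
        (∀ l ∈ L, l.2 - τ ∈ W → l.2 - τ ∈ interior W) ∧ Q = T.filter fun z => f z - τ ∈ W) →
      (𝒬.card : ℕ∞) ≤ S.encard := by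
  obtain ⟨w, hw, hWw⟩ := hW.exists_abs_le
  obtain ⟨r, hr, hrL⟩ := hL.exists_separation ((w + C) + (w + C))
  -- The bound `1 / 2` avoids the cap and keeps displacements inside the balls of agreement; `r / 2`
  -- makes two displacements add up to less than `r`.
  refine ⟨min (1 / 2) (r / 2), by positivity, fun B S hS T f hT 𝒬 h𝒬 => ?_⟩
  set ε := min (1 / 2) (r / 2) with hε
  have hε2 : ε ≤ 1 / 2 := min_le_left _ _
  have hεr : ε ≤ r / 2 := min_le_right _ _
  have hbd : ∀ {h τ : ℝ}, |τ| ≤ C → h - τ ∈ W → |h| ≤ w + C := fun {h τ} hτ hh => by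
    calc |h| = |h - τ + τ| := by rw [sub_add_cancel]
      _ ≤ _ := (abs_add_le _ _).trans (add_le_add (hWw _ hh) hτ)
  have hchoose : ∀ Q : 𝒬, ∃ ξ ∈ S, ∃ τ : ℝ, |τ| ≤ C ∧ (Q : Finset α) =
      T.filter (fun z => f z - τ ∈ W) ∧
        ∀ s ∈ B, deloneDist (shift s (modelSet L {h | h - τ ∈ W})) (shift s ξ) < ε := by
    rintro ⟨Q, hQ⟩
    obtain ⟨τ, hτC, hτ, hQτ⟩ := h𝒬 Q hQ
    obtain ⟨ξ, hξ, h⟩ := hS _ (hL.modelSet_mem_hull hW hτ)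
    exact ⟨ξ, hξ, τ, hτC, hQτ, h⟩
  choose ξ hξS τ hτC hQ hd using hchoose
  -- A point `x` of the first model set is passed, via the common `ξ`, to a point of the second one
  -- at distance less than `r`. Separation forces both to come from the same lattice point, so `f z`
  -- lies in the second window too.
  have hsub : ∀ Q Q' : 𝒬, ξ Q = ξ Q' → (Q : Finset α) ⊆ Q' := by
    intro Q Q' hQQ z hz
    rw [hQ Q, Finset.mem_filter] at hz
    obtain ⟨x, hxB, hxL⟩ := hT z hz.1
    obtain ⟨ε₁, h0, hlt, δ, hδ, heq⟩ := exists_inter_eq_of_deloneDist_lt hε2 (hd Q x hxB)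
    obtain ⟨ε₂, h0', hlt', δ', hδ', heq'⟩ := exists_inter_eq_of_deloneDist_lt hε2 (hd Q' x hxB)
    have hball : ∀ {η : ℝ}, 0 < η → η < ε → -δ ∈ Metric.ball (0 : G) (1 / η) := by
      intro η hη hηε
      rw [mem_ball_zero_iff, norm_neg]
      have : 2 ≤ 1 / η := (le_one_div two_pos hη).2 (hηε.le.trans hε2)
      linarith
    have h1 : -δ ∈ shift x (ξ Q) := by
      have : -δ ∈ shift δ (shift x (modelSet L {h | h - τ Q ∈ W})) ∩ Metric.ball 0 (1 / ε₁) := by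
        refine ⟨?_, hball h0 hlt⟩
        rw [mem_shift, mem_shift, neg_add_cancel, zero_add]
        exact ⟨f z, hz.2, hxL⟩
      rw [heq] at this
      exact this.1
    have h2 : -δ ∈ shift δ' (shift x (modelSet L {h | h - τ Q' ∈ W})) ∩
        Metric.ball 0 (1 / ε₂) := by
      rw [heq', ← hQQ]
      exact ⟨h1, hball h0' hlt'⟩
    obtain ⟨k, hk, hkL⟩ := h2.1
    have h3 := hrL _ (L.sub_mem hkL hxL) (by
      simp only [Prod.fst_sub, add_sub_cancel_right]
      calc ‖-δ + δ'‖ ≤ ‖-δ‖ + ‖δ'‖ := norm_add_le _ _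
        _ < r := by rw [norm_neg]; linarith)
      ((abs_sub _ _).trans (add_le_add (hbd (hτC Q') hk) (hbd (hτC Q) hz.2)))
    have h4 : k = f z := sub_eq_zero.1 (congrArg Prod.snd h3)
    rw [hQ Q', Finset.mem_filter]
    exact ⟨hz.1, h4 ▸ hk⟩
  have hinj : Function.Injective ξ := fun Q Q' h =>
    Subtype.ext (Finset.Subset.antisymm (hsub Q Q' h) (hsub Q' Q h.symm))
  calc (𝒬.card : ℕ∞) = (univ : Set 𝒬).encard := by
        rw [encard_univ, ENat.card_eq_coe_fintype_card, Fintype.card_coe]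
    _ = (range ξ).encard := by rw [← image_univ, hinj.encard_image]
    _ ≤ S.encard := encard_le_encard (range_subset_iff.2 hξS)

-- By minimality `ζ` agrees on a large ball with a translate by `g` of the model set for the window
-- `W + t`. Subtracting a lattice point near `(g, 0)` leaves a displacement in a fixed ball, at the
-- price of moving the window to `W + (t - l.2)`. The label consists of the pattern of this window
-- on `X` and a net point near the displacement; the size `v` of the net does not depend on `F`.
open Classical in
theorem exists_spanNumber_le_mul_card
    (hmin : IsMinimalHull (modelSet L W)) {w t R : ℝ} (hWw : ∀ h ∈ W, |h| ≤ w)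
    (ht : modelSet L {h | h - t ∈ W} ∈ hull (modelSet L W))
    (hR : ∀ p : G × ℝ, ∃ l ∈ L, ‖p - l‖ < R) {ε : ℝ} (hε : 0 < ε) :
    ∃ (v : ℕ) (ρ : ℝ), ∀ (F : Set G), Bornology.IsBounded F → ∀ X : Finset (G × ℝ),
      (∀ l, l ∈ X ↔ l ∈ L ∧ l.1 ∈ Metric.closedBall 0 ρ + F ∧ |l.2| ≤ w + (|t| + R)) →
      ∃ 𝒜 : Finset (Finset (G × ℝ)),
        (∀ P ∈ 𝒜, ∃ l ∈ L, |l.2| ≤ R ∧ P = X.filter fun m => m.2 - (t - l.2) ∈ W) ∧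
        spanNumber deloneDist shift (hull (modelSet L W)) F ε (hull (modelSet L W)) ≤
          ((v * 𝒜.card : ℕ) : ℕ∞) := by
  set η := ε / 2 with hη
  have hη0 : 0 < η := half_pos hε
  obtain ⟨V, -, hVfin, hV⟩ := (isCompact_closedBall (0 : G) R).finite_cover_balls (half_pos hη0)
  -- Sets are compared on balls of radius `1 / η`; `R` allows for the displacement `v + δ'` and `η`
  -- for `δ' - δ`.
  set ρ := 1 / η + R + η with hρ
  refine ⟨hVfin.toFinset.card, ρ, fun F hF X hX => ?_⟩
  refine ⟨X.powerset.filter fun P => ∃ l ∈ L, |l.2| ≤ R ∧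
    P = X.filter fun m => m.2 - (t - l.2) ∈ W, fun P hP => (Finset.mem_filter.1 hP).2, ?_⟩
  rw [← Finset.card_product]
  have hbdd : Bornology.IsBounded (Metric.closedBall (0 : G) ρ + F) :=
    Metric.isBounded_closedBall.add hF
  obtain ⟨R', hR'⟩ := hbdd.subset_ball (0 : G)
  have hK : ∀ {x s : G}, ‖x‖ ≤ ρ → s ∈ F → x + s ∈ Metric.closedBall (0 : G) ρ + F :=
    fun hx hs => ⟨_, mem_closedBall_zero_iff.2 hx, _, hs, rfl⟩
  refine spanNumber_le_card Subset.rfl _ (fun ζ d => ∃ δ : G, ∃ l ∈ L, ‖δ‖ < η / 2 ∧ |l.2| ≤ R ∧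
    ‖d.1 + δ‖ < R ∧ (d.2 = X.filter fun m => m.2 - (t - l.2) ∈ W) ∧
      ∀ x ∈ Metric.ball (0 : G) R', x ∈ ζ ↔
        x + (d.1 + δ) ∈ modelSet L {h | h - (t - l.2) ∈ W}) ?_ ?_
  · intro ζ hζ
    obtain ⟨g, hg⟩ := hmin.exists_inter_eq ht hζ R'
    obtain ⟨l, hl, hlR⟩ := hR (g, 0)
    have h1 : ‖g - l.1‖ < R := (norm_fst_le _).trans_lt hlR
    have h2 : |l.2| ≤ R := by
      have : ‖0 - l.2‖ < R := (norm_snd_le _).trans_lt hlR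
      rw [zero_sub, norm_neg] at this
      exact this.le
    obtain ⟨v, hvV, hv⟩ := mem_iUnion₂.1 (hV (mem_closedBall_zero_iff.2 h1.le))
    refine ⟨(v, X.filter fun m => m.2 - (t - l.2) ∈ W), ?_, g - l.1 - v, l, hl, ?_, h2, ?_, rfl,
      fun x hx => ?_⟩
    · rw [Finset.mem_product, Finite.mem_toFinset]
      exact ⟨hvV, Finset.mem_filter.2
        ⟨Finset.mem_powerset.2 (Finset.filter_subset _ _), l, hl, h2, rfl⟩⟩
    · rwa [mem_ball_iff_norm] at hv
    · rwa [add_sub_cancel]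
    · have h3 : x ∈ ζ ↔ x ∈ shift g (modelSet L {h | h - t ∈ W}) := by
        have := Set.ext_iff.1 hg x
        simpa only [mem_inter_iff, hx, and_true] using this.symm
      rw [h3, add_sub_cancel]
      constructor
      · rintro ⟨h, hh, hxL⟩
        refine ⟨h - l.2, ?_, ?_⟩
        · rwa [mem_ofPred_eq, sub_sub_sub_cancel_right]
        · have := L.sub_mem hxL hl
          rwa [show (x + g, h) - l = (x + (g - l.1), h - l.2) from
            Prod.ext (add_sub_assoc _ _ _) rfl] at this
      · rintro ⟨h, hh, hxL⟩
        refine ⟨h + l.2, ?_, ?_⟩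
        · have heq : h + l.2 - t = h - (t - l.2) := by ring
          rwa [mem_ofPred_eq, heq]
        · have := L.add_mem hxL hl
          rwa [show (x + (g - l.1), h) + l = (x + g, h + l.2) from
            Prod.ext (by simp [add_assoc]) rfl] at this
  · rintro ζ - ζ' - ⟨v, P⟩ ⟨δ, l, hl, hδ, hl2, hvδ, hP, hζ⟩ ⟨δ', l', hl', hδ', hl2', hvδ', hP', hζ'⟩
      s hs
    dsimp only at hvδ hP hζ hvδ' hP' hζ'
    have hδδ : ‖δ' - δ‖ < η := (norm_sub_le _ _).trans_lt (by linarith)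
    refine deloneDist_lt_of_inter_eq hη0 (half_lt_self hε) hδδ ?_
    have hmem : ∀ {u : G} {l : G × ℝ}, |l.2| ≤ R → u ∈ Metric.closedBall (0 : G) ρ + F →
        (u ∈ modelSet L {h | h - (t - l.2) ∈ W} ↔
          ∃ h, (u, h) ∈ X.filter fun m => m.2 - (t - l.2) ∈ W) := by
      intro u l hl hu
      constructor
      · rintro ⟨h, hh, huL⟩
        refine ⟨h, Finset.mem_filter.2 ⟨(hX _).2 ⟨huL, hu, ?_⟩, hh⟩⟩
        calc |h| = |h - (t - l.2) + (t - l.2)| := by rw [sub_add_cancel]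
          _ ≤ |h - (t - l.2)| + |t - l.2| := abs_add_le _ _
          _ ≤ _ := add_le_add (hWw _ hh) ((abs_sub _ _).trans (by gcongr))
      · rintro ⟨h, hh⟩
        obtain ⟨h1, h2⟩ := Finset.mem_filter.1 hh
        exact ⟨h, h2, ((hX _).1 h1).1⟩
    ext x
    simp only [mem_inter_iff, mem_shift]
    refine and_congr_left fun hx => ?_
    rw [mem_ball_zero_iff] at hx
    have hR0 : 0 < R := (norm_nonneg _).trans_lt hvδ
    have hm1 : x + (δ' - δ) + s ∈ Metric.closedBall (0 : G) ρ + F :=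
      hK ((norm_add_le _ _).trans (by linarith)) hs
    have hm2 : x + s ∈ Metric.closedBall (0 : G) ρ + F := hK (by linarith) hs
    have hm3 : x + s + (v + δ') ∈ Metric.closedBall (0 : G) ρ + F := by
      rw [add_right_comm]
      exact hK ((norm_add_le _ _).trans (by linarith)) hs
    rw [hζ _ (hR' hm1), hζ' _ (hR' hm2),
      show x + (δ' - δ) + s + (v + δ) = x + s + (v + δ') by abel, hmem hl2 hm3, hmem hl2' hm3,
      ← hP, ← hP']

/-- Shearer's inequality for the patterns cut out by translates of the window. -/
theorem card_patterns_pow_le {α : Type*} [AddCommGroup α] [DecidableEq α] (f : α →+ ℝ)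
    [DecidablePred (· ∈ W)] {X T : Finset α} (hT : T.Nonempty)
    {𝒯 : Set ℝ} {𝒜 : Finset (Finset α)}
    (h𝒜 : ∀ P ∈ 𝒜, ∃ τ ∈ 𝒯, P = X.filter fun m => f m - τ ∈ W) {M : ℕ}
    (hM : ∀ y ∈ X - T, ∀ 𝒬 : Finset (Finset α),
      (∀ Q ∈ 𝒬, ∃ τ ∈ 𝒯, Q = T.filter fun z => f z - (τ - f y) ∈ W) → 𝒬.card ≤ M) :
    𝒜.card ^ T.card ≤ M ^ (X - T).card := by
  have hsub : ∀ P ∈ 𝒜, P ⊆ X := fun P hP => by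
    obtain ⟨τ, -, rfl⟩ := h𝒜 P hP
    exact Finset.filter_subset _ _
  refine (card_pow_le_prod_card_trace hT.card_ne_zero (X - T) (fun y => T.image (y + ·)) X 𝒜 hsub
    fun x hx => ?_).trans ?_
  -- Each `z ∈ T` gives one translate `(x - z) + T` containing `x`.
  · refine Finset.card_le_card_of_injOn (x - ·) (fun z hz => ?_) fun z _ z' _ h => by simpa using h
    refine Finset.mem_coe.2 (Finset.mem_filter.2 ⟨Finset.sub_mem_sub hx hz, ?_⟩)
    exact Finset.mem_image.2 ⟨z, hz, sub_add_cancel _ _⟩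
  · refine Finset.prod_le_pow_card _ _ _ fun y hy => ?_
    have hchoose : ∀ P : Finset α, ∃ τ, P ∈ 𝒜 → τ ∈ 𝒯 ∧ P = X.filter fun m => f m - τ ∈ W := by
      intro P
      by_cases hP : P ∈ 𝒜
      · obtain ⟨τ, h⟩ := h𝒜 P hP
        exact ⟨τ, fun _ => h⟩
      · exact ⟨0, fun h => absurd h hP⟩
    choose τ hτ using hchoose
    -- By additivity of `f`, the trace on `y + T` is determined by the pattern on `T` of the window
    -- moved by `f y`.
    let q : Finset α → Finset α := fun P => T.filter fun z => f z - (τ P - f y) ∈ W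
    have himage : 𝒜.image (· ∩ T.image (y + ·)) ⊆
        (𝒜.image q).image fun Q => X ∩ Q.image (y + ·) := by
      intro s hs
      obtain ⟨P, hP, rfl⟩ := Finset.mem_image.1 hs
      refine Finset.mem_image.2 ⟨q P, Finset.mem_image_of_mem q hP, ?_⟩
      ext m
      have hPm : m ∈ P ↔ m ∈ X ∧ f m - τ P ∈ W := by
        conv_lhs => rw [(hτ P hP).2]
        exact Finset.mem_filter
      simp only [Finset.mem_inter, Finset.mem_image, q, Finset.mem_filter, hPm, and_assoc]
      refine and_congr_right fun _ => ⟨?_, ?_⟩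
      · rintro ⟨z, hz, hzW, rfl⟩
        refine ⟨?_, z, hz, rfl⟩
        rwa [map_add, add_comm, ← sub_sub_eq_add_sub]
      · rintro ⟨hW', z, hz, rfl⟩
        refine ⟨z, hz, ?_, rfl⟩
        rwa [map_add, add_comm, ← sub_sub_eq_add_sub] at hW'
    refine ((Finset.card_le_card himage).trans Finset.card_image_le).trans (hM y hy _ ?_)
    intro Q hQ
    obtain ⟨P, hP, rfl⟩ := Finset.mem_image.1 hQ
    exact ⟨τ P, (hτ P hP).1, rfl⟩

end Patterns

end CutProject

namespace CutProject

/-! ### Vanishing of the entropy -/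

theorem lt_ofReal_exp_of_log_div_lt {x v : ℝ≥0∞} {κ : ℝ} (hv : 0 < v) (hv' : v ≠ ⊤)
    (h : ENNReal.log x / (v : EReal) < κ) : x < ENNReal.ofReal (Real.exp (κ * v.toReal)) := by
  rw [EReal.div_lt_iff (EReal.coe_ennreal_pos.2 hv) (EReal.coe_ennreal_eq_top_iff.not.2 hv')] at h
  rwa [← ENNReal.log_lt_log_iff, ENNReal.log_ofReal_of_pos (Real.exp_pos _), Real.log_exp,
    EReal.coe_mul, EReal.coe_ennreal_toReal hv']

theorem log_div_le_of_le_ofReal_exp {x v : ℝ≥0∞} {κ c : ℝ} (hv : 0 < v) (hv' : v ≠ ⊤)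
    (hc : c ≤ κ * v.toReal) (h : x ≤ ENNReal.ofReal (Real.exp c)) :
    ENNReal.log x / (v : EReal) ≤ κ := by
  rw [EReal.div_le_iff_le_mul (EReal.coe_ennreal_pos.2 hv) (EReal.coe_ennreal_eq_top_iff.not.2 hv')]
  have h1 := ENNReal.log_le_log h
  rw [ENNReal.log_ofReal_of_pos (Real.exp_pos _), Real.log_exp] at h1
  refine h1.trans ?_
  rw [mul_comm, ← EReal.coe_ennreal_toReal hv', ← EReal.coe_mul]
  exact EReal.coe_le_coe_iff.2 hc

section Entropy

variable {G G' : Type*} [NormedAddCommGroup G] [NormedAddCommGroup G'] [ProperSpace G']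
  [MeasureSpace G'] [BorelSpace G'] [NoncompactSpace G'] [(volume : Measure G').IsAddHaarMeasure]
  {L : AddSubgroup (G × ℝ)} {L' : AddSubgroup (G' × ℝ)} {W : Set ℝ}

open Classical in
/-- If the entropy of the model set of `L'` vanishes, then there are finite subsets `T` of `L`, with
bounded internal coordinates, on which generic translates of `W` cut out few patterns. -/
theorem exists_finset_card_traces_le (hL' : IsCutAndProjectScheme L') (hW : IsProperWindow W)
    {B : ℕ → Set G'} (hB : IsVanHove volume B) (hzero : hullEntropy B (modelSet L' W) ≤ 0)
    (e : G → G') (he : ∀ z ∈ L', ∃ l ∈ L, e l.1 = z.1 ∧ l.2 = z.2) {R : ℝ}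
    (hR : ∀ p : G' × ℝ, ∃ l ∈ L', ‖p - l‖ < R) (C : ℝ) {κ : ℝ} (hκ : 0 < κ) :
    ∃ (T : Finset (G × ℝ)) (M : ℕ), T.Nonempty ∧ (∀ z ∈ T, z ∈ L ∧ |z.2| ≤ R) ∧
      (M : ℝ) ≤ Real.exp (κ * (2 * (T.card * (volume (Metric.ball (0 : G') R)).toReal))) ∧
      ∀ 𝒬 : Finset (Finset (G × ℝ)), (∀ Q ∈ 𝒬, ∃ τ : ℝ, |τ| ≤ C ∧
        (∀ l ∈ L', l.2 - τ ∈ W → l.2 - τ ∈ interior W) ∧ Q = T.filter fun z => z.2 - τ ∈ W) →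
      𝒬.card ≤ M := by
  obtain ⟨ε, hε, hcount⟩ := hL'.exists_card_traces_le hW (G × ℝ) C
  have hscale : entropyAtScale volume deloneDist shift (hull (modelSet L' W)) B ε
      (hull (modelSet L' W)) ≤ 0 := le_trans (le_iSup₂ (f := fun (ε : ℝ) (_ : 0 < ε) =>
        entropyAtScale volume deloneDist shift (hull (modelSet L' W)) B ε
          (hull (modelSet L' W))) ε hε) hzero
  have hev := eventually_lt_of_limsup_lt (hscale.trans_lt (EReal.coe_pos.2 hκ))
  obtain ⟨n, hn, hpos, hvol⟩ :=
    (hev.and (hB.eventually_volume_pos.and (hB.eventually_volume_le R))).exists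
  have hfin := (hB.volume_lt_top n).ne
  have hspan := lt_ofReal_exp_of_log_div_lt hpos hfin hn
  set b := (volume (B n)).toReal
  have hb : 0 < b := ENNReal.toReal_pos hpos.ne' hfin
  obtain ⟨M, hM⟩ := ENat.ne_top_iff_exists.1 (fun h => by
    rw [h, ENat.toENNReal_top] at hspan
    exact absurd hspan (not_lt.2 le_top) : spanNumber deloneDist shift (hull (modelSet L' W)) (B n) ε
      (hull (modelSet L' W)) ≠ ⊤)
  have hMb : (M : ℝ) ≤ Real.exp (κ * b) := by
    rw [← hM, ENat.toENNReal_coe, ← ENNReal.ofReal_natCast,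
      ENNReal.ofReal_lt_ofReal_iff (Real.exp_pos _)] at hspan
    exact hspan.le
  have hTfin : ((B n ×ˢ Metric.closedBall (0 : ℝ) R) ∩ (L' : Set (G' × ℝ))).Finite :=
    hL'.finite_inter ((hB.isBounded n).prod Metric.isBounded_closedBall)
  -- Lifting to `L` keeps the internal coordinates, hence the patterns, and is injective because `e`
  -- recovers the physical coordinate.
  choose! σ hσL hσe hσ using he
  have hT' : ∀ z, z ∈ hTfin.toFinset ↔ (z.1 ∈ B n ∧ |z.2| ≤ R) ∧ z ∈ L' := by
    intro z
    simp [mem_prod]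
  have hcard : (hTfin.toFinset.image σ).card = hTfin.toFinset.card := by
    refine Finset.card_image_of_injOn fun z hz z' hz' h => ?_
    have hz := ((hT' z).1 hz).2
    have hz' := ((hT' z').1 hz').2
    refine Prod.ext ?_ ?_
    · rw [← hσe z hz, ← hσe z' hz', h]
    · rw [← hσ z hz, ← hσ z' hz', h]
  -- The lattice points over `B n` are numerous enough to turn a bound in terms of volume into one
  -- in terms of `T.card`.
  have hbT : b ≤ 2 * ((hTfin.toFinset.image σ).card *
      (volume (Metric.ball (0 : G') R)).toReal) := by
    have h1 : volume (B n) ≤ 2 * (hTfin.toFinset.card * volume (Metric.ball (0 : G') R)) := by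
      refine hvol.trans ?_
      gcongr
      exact volume_le_card_mul hR fun l hl h1 h2 => (hT' l).2 ⟨⟨h1, h2⟩, hl⟩
    have h2 := ENNReal.toReal_mono (ENNReal.mul_ne_top ENNReal.ofNat_ne_top
      (ENNReal.mul_ne_top (ENNReal.natCast_ne_top _) measure_ball_lt_top.ne)) h1
    rw [hcard]
    simpa using h2
  refine ⟨hTfin.toFinset.image σ, M, ?_, ?_, ?_, ?_⟩
  · rw [← Finset.card_pos, Nat.pos_iff_ne_zero]
    intro h0
    rw [h0, Nat.cast_zero, zero_mul, mul_zero] at hbT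
    exact absurd hbT (not_le.2 hb)
  · intro z hz
    obtain ⟨z', hz', rfl⟩ := Finset.mem_image.1 hz
    have := (hT' z').1 hz'
    exact ⟨hσL z' this.2, by rw [hσ z' this.2]; exact this.1.2⟩
  · exact hMb.trans (Real.exp_le_exp.2 (by gcongr))
  · intro 𝒬 h𝒬
    have hlt : spanNumber deloneDist shift (hull (modelSet L' W)) (B n) ε
        (hull (modelSet L' W)) < (M + 1 : ℕ) := by
      rw [← hM]
      exact_mod_cast Nat.lt_succ_self M
    obtain ⟨S, hS⟩ := iInf_lt_iff.1 hlt
    obtain ⟨⟨-, hspanS⟩, hSM⟩ := iInf_lt_iff.1 hS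
    have := (hcount (B n) S hspanS (hTfin.toFinset.image σ) Prod.snd (fun z hz => by
      obtain ⟨z', hz', rfl⟩ := Finset.mem_image.1 hz
      have := (hT' z').1 hz'
      exact ⟨z'.1, this.1.1, by rw [hσ z' this.2]; exact this.2⟩) 𝒬 h𝒬).trans_lt hSM
    exact Nat.lt_succ_iff.1 (by exact_mod_cast this)

variable [ProperSpace G] [MeasureSpace G] [BorelSpace G] [NoncompactSpace G]
  [(volume : Measure G).IsAddHaarMeasure]

open Classical in
/-- The entropy of a minimal model set of `L` vanishes if that of the model set of `L'` does, where
the internal coordinates of `L'` are also internal coordinates of `L`. -/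
theorem hullEntropy_le_zero (hL : IsCutAndProjectScheme L) (hL' : IsCutAndProjectScheme L')
    (hW : IsProperWindow W) (hmin : IsMinimalHull (modelSet L W))
    {B : ℕ → Set G'} (hB : IsVanHove volume B) (hzero : hullEntropy B (modelSet L' W) ≤ 0)
    (e : G → G') (he : ∀ z ∈ L', ∃ l ∈ L, e l.1 = z.1 ∧ l.2 = z.2)
    {F : ℕ → Set G} (hF : IsVanHove volume F) : hullEntropy F (modelSet L W) ≤ 0 := by
  obtain ⟨w, -, hWw⟩ := hW.exists_abs_le
  obtain ⟨t, ht⟩ := hL.exists_generic hW.isCompact.isClosed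
  obtain ⟨R, hR0, hR⟩ := hL.exists_norm_sub_lt
  obtain ⟨R', hR0', hR'⟩ := hL'.exists_norm_sub_lt
  set C := w + (|t| + R) with hC
  obtain ⟨r, hr, hsep⟩ := hL.exists_card_mul_le (C + R')
  set c := (volume (Metric.ball (0 : G) r)).toReal with hc
  have hc0 : 0 < c := ENNReal.toReal_pos (Metric.measure_ball_pos _ _ hr).ne'
    measure_ball_lt_top.ne
  set c' := (volume (Metric.ball (0 : G') R')).toReal with hc'
  have hc0' : 0 ≤ c' := ENNReal.toReal_nonneg
  refine iSup₂_le fun ε hε => ?_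
  -- The summand 1 absorbs the factor `v`. The 4 combines the factor 2 in the bound on `M` with the
  -- factor 2 from enlarging `F n`.
  have key : ∀ κ : ℝ, 0 < κ → entropyAtScale volume deloneDist shift (hull (modelSet L W)) F ε
      (hull (modelSet L W)) ≤ ((κ * (1 + 4 * c' / c) : ℝ) : EReal) := by
    intro κ hκ
    -- The last bound is for window positions `t - l.2 - y.2` with `|l.2| ≤ R` and `y ∈ X - T`.
    obtain ⟨T, M, hTne, hT, hM, htrace⟩ := exists_finset_card_traces_le hL' hW hB hzero e he hR'
      (|t| + R + (C + R')) hκ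
    obtain ⟨v, ρ, hspan⟩ := exists_spanNumber_le_mul_card hmin hWw
      (hL.modelSet_mem_hull hW ht) hR hε
    obtain ⟨r', hr'⟩ : ∃ r', ∀ z ∈ T, ‖z.1‖ ≤ r' :=
      ⟨∑ z ∈ T, ‖z.1‖, fun z hz =>
        Finset.single_le_sum (f := fun z : G × ℝ => ‖z.1‖) (fun _ _ => norm_nonneg _) hz⟩
    refine limsup_le_of_le (by isBoundedDefault) ?_
    filter_upwards [hF.eventually_volume_pos, hF.eventually_volume_add_le (r + (ρ + r')),
      hF.tendsto_volume.eventually_const_le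
        (ENNReal.ofReal_lt_top (r := Real.log v / κ))] with n hpos hadd hlog
    have hfin := (hF.volume_lt_top n).ne
    set b := (volume (F n)).toReal with hb
    have hXfin : (((Metric.closedBall 0 ρ + F n) ×ˢ Metric.closedBall (0 : ℝ) C) ∩
        (L : Set (G × ℝ))).Finite :=
      hL.finite_inter ((Metric.isBounded_closedBall.add (hF.isBounded n)).prod
        Metric.isBounded_closedBall)
    set X := hXfin.toFinset with hXdef
    have hX : ∀ l, l ∈ X ↔ l ∈ L ∧ l.1 ∈ Metric.closedBall 0 ρ + F n ∧ |l.2| ≤ C := by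
      intro l
      simp only [hXdef, Finite.mem_toFinset, mem_inter_iff, mem_prod, mem_closedBall_zero_iff,
        Real.norm_eq_abs, SetLike.mem_coe]
      tauto
    obtain ⟨𝒜, h𝒜, hle⟩ := hspan (F n) (hF.isBounded n) X hX
    have hY : ∀ y ∈ X - T, y ∈ L ∧ y.1 ∈ Metric.closedBall 0 (ρ + r') + F n ∧ |y.2| ≤ C + R' := by
      intro y hy
      obtain ⟨x, hx, z, hz, rfl⟩ := Finset.mem_sub.1 hy
      obtain ⟨hxL, ⟨u, hu, s, hs, hus⟩, hx2⟩ := (hX x).1 hx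
      refine ⟨L.sub_mem hxL (hT z hz).1, ⟨u - z.1, ?_, s, hs, ?_⟩, ?_⟩
      · rw [mem_closedBall_zero_iff] at hu ⊢
        exact (norm_sub_le _ _).trans (add_le_add hu (hr' z hz))
      · dsimp only at hus ⊢
        rw [Prod.fst_sub, ← hus]
        abel
      · exact (abs_sub _ _).trans (add_le_add hx2 (hT z hz).2)
    have hYcard : ((X - T).card : ℝ) * c ≤ 2 * b := by
      have h1 := hsep _ (X - T) hY
      have hball : Metric.closedBall (0 : G) r + Metric.closedBall 0 (ρ + r') ⊆
          Metric.closedBall 0 (r + (ρ + r')) := by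
        refine add_subset_iff.2 fun x hx y hy => ?_
        rw [mem_closedBall_zero_iff] at hx hy ⊢
        exact (norm_add_le _ _).trans (add_le_add hx hy)
      rw [← add_assoc] at h1
      replace h1 := h1.trans (measure_mono (add_subset_add_right hball))
      have h2 := ENNReal.toReal_mono (ENNReal.mul_ne_top ENNReal.ofNat_ne_top hfin)
        (h1.trans hadd)
      simpa using h2
    have hshearer : 𝒜.card ^ T.card ≤ M ^ (X - T).card := by
      refine card_patterns_pow_le (AddMonoidHom.snd G ℝ) hTne
        (𝒯 := {τ | ∃ l ∈ L, |l.2| ≤ R ∧ τ = t - l.2}) (W := W) (fun P hP => ?_)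
        fun y hy 𝒬 h𝒬 => htrace 𝒬 fun Q hQ => ?_
      · obtain ⟨l, hl, hlR, rfl⟩ := h𝒜 P hP
        exact ⟨_, ⟨l, hl, hlR, rfl⟩, rfl⟩
      · obtain ⟨_, ⟨l, hl, hlR, rfl⟩, rfl⟩ := h𝒬 Q hQ
        obtain ⟨hyL, -, hy2⟩ := hY y hy
        refine ⟨t - l.2 - y.2, ?_, fun z hz hzW => ?_, rfl⟩
        · exact (abs_sub _ _).trans (add_le_add ((abs_sub _ _).trans (by gcongr)) hy2)
        -- The translate is generic for `L'` because `z` lifts to `m ∈ L`, and `t` is generic for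
        -- the lattice point `m + l + y`.
        · obtain ⟨m, hm, -, hmz⟩ := he z hz
          have h1 := ht (m + l + y) (L.add_mem (L.add_mem hm hl) hyL)
          have h2 : (m + l + y).2 - t = z.2 - (t - l.2 - y.2) := by
            simp only [Prod.snd_add, hmz]
            ring
          rw [h2] at h1
          exact h1 hzW
    have hk : (0 : ℝ) < T.card := by exact_mod_cast hTne.card_pos
    have hA : (𝒜.card : ℝ) ≤ Real.exp (κ * (2 * c') * (X - T).card) := by
      rw [← pow_le_pow_iff_left₀ (Nat.cast_nonneg _) (Real.exp_pos _).le hTne.card_ne_zero]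
      calc (𝒜.card : ℝ) ^ T.card ≤ (M : ℝ) ^ (X - T).card := by exact_mod_cast hshearer
        _ ≤ Real.exp (κ * (2 * (T.card * c'))) ^ (X - T).card := by gcongr
        _ = _ := by
          rw [← Real.exp_nat_mul, ← Real.exp_nat_mul]
          congr 1
          ring
    have hA' : (𝒜.card : ℝ) ≤ Real.exp (κ * (4 * c' / c) * b) := by
      refine hA.trans (Real.exp_le_exp.2 ?_)
      have h1 : ((X - T).card : ℝ) ≤ 2 * b / c := (le_div_iff₀ hc0).2 hYcard
      calc κ * (2 * c') * (X - T).card ≤ κ * (2 * c') * (2 * b / c) := by gcongr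
        _ = _ := by ring
    have hv : (v : ℝ) ≤ Real.exp (κ * b) := by
      refine (Real.le_exp_log _).trans (Real.exp_le_exp.2 ?_)
      have := (ENNReal.ofReal_le_iff_le_toReal hfin).1 hlog
      rwa [div_le_iff₀' hκ] at this
    refine log_div_le_of_le_ofReal_exp (c := κ * b + κ * (4 * c' / c) * b) hpos hfin
      (le_of_eq (by ring)) ?_
    calc ((spanNumber deloneDist shift (hull (modelSet L W)) (F n) ε
          (hull (modelSet L W)) : ℕ∞) : ℝ≥0∞) ≤ (((v * 𝒜.card : ℕ) : ℕ∞) : ℝ≥0∞) :=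
          ENat.toENNReal_le.2 hle
      _ = ENNReal.ofReal ((v * 𝒜.card : ℕ) : ℝ) := by
          rw [ENat.toENNReal_coe, ENNReal.ofReal_natCast]
      _ ≤ _ := by
          refine ENNReal.ofReal_le_ofReal ?_
          rw [Nat.cast_mul, Real.exp_add]
          gcongr
  refine EReal.le_of_forall_lt_iff_le.1 fun x hx => ?_
  have hx0 : 0 < x := EReal.coe_pos.1 hx
  have hd : 0 < 1 + 4 * c' / c := by positivity
  have := key (x / (1 + 4 * c' / c)) (div_pos hx0 hd)
  rwa [div_mul_cancel₀ _ hd.ne'] at this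

end Entropy

/-! ### Entropy on subsets, and lifting the planar lattice -/

theorem spanNumber_mono {T X : Type*} [AddCommGroup T] {d : X → X → ℝ} {φ : T → X → X}
    {Y C C' : Set X} {F : Set T} {ε : ℝ} (h : C ⊆ C') :
    spanNumber d φ Y F ε C ≤ spanNumber d φ Y F ε C' :=
  le_iInf₂ fun S hS => iInf₂_le S ⟨hS.1, fun ζ hζ => hS.2 ζ (h hζ)⟩

theorem entropyOn_mono {T X : Type*} [AddCommGroup T] [MeasurableSpace T] {μ : Measure T}
    {d : X → X → ℝ} {φ : T → X → X} {Y C C' : Set X} {A : ℕ → Set T} (h : C ⊆ C') :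
    entropyOn μ d φ Y A C ≤ entropyOn μ d φ Y A C' :=
  iSup₂_mono fun _ _ => limsup_le_limsup (Eventually.of_forall fun _ =>
    EReal.div_le_div_right_of_nonneg (EReal.coe_ennreal_nonneg _)
      (ENNReal.log_le_log (ENat.toENNReal_le.2 (spanNumber_mono h))))

/-- A spanning set of a non-empty set is non-empty. The empty set has spanning number 0, with
logarithm `⊥`, so for fibres the surjectivity of `β` is needed. -/
theorem entropyOn_nonneg {T X : Type*} [AddCommGroup T] [MeasurableSpace T] {μ : Measure T}
    {d : X → X → ℝ} {φ : T → X → X} {Y C : Set X} {A : ℕ → Set T} (h : C.Nonempty) :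
    0 ≤ entropyOn μ d φ Y A C := by
  refine le_trans ?_ (le_iSup₂ (f := fun (ε : ℝ) (_ : 0 < ε) =>
    entropyAtScale μ d φ Y A ε C) 1 one_pos)
  refine le_limsup_of_frequently_le (Frequently.of_forall fun n => ?_)
  refine EReal.div_nonneg (ENNReal.zero_le_log_iff.2 ?_) (EReal.coe_ennreal_nonneg _)
  rw [← ENat.toENNReal_one, ENat.toENNReal_le]
  refine le_iInf₂ fun S hS => ?_
  obtain ⟨ζ, hζ⟩ := h
  obtain ⟨ξ, hξ, -⟩ := hS.2 ζ hζ
  exact one_le_encard_iff_nonempty.2 ⟨ξ, hξ⟩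

/-- The columns `i` and `N + 1` of `A` lift the two generators. -/
theorem exists_mem_matrixLattice_of_mem_planarLattice {N : ℕ}
    (A : Matrix (Fin (N + 1)) (Fin (N + 1)) ℝ) (i : Fin N) {z : ℝ × ℝ}
    (hz : z ∈ planarLattice A i) : ∃ l ∈ matrixLattice A, l.1 i = z.1 ∧ l.2 = z.2 := by
  induction hz using AddSubgroup.closure_induction with
  | mem z hz =>
    rcases hz with rfl | rfl
    · exact ⟨_, AddSubgroup.subset_closure ⟨i.castSucc, rfl⟩, rfl, rfl⟩
    · exact ⟨_, AddSubgroup.subset_closure ⟨Fin.last N, rfl⟩, rfl, rfl⟩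
  | zero => exact ⟨0, zero_mem _, rfl, rfl⟩
  | add x y _ _ hx hy =>
    obtain ⟨l, hl, h1, h2⟩ := hx
    obtain ⟨m, hm, h3, h4⟩ := hy
    exact ⟨l + m, add_mem hl hm, by simp [h1, h3], by simp [h2, h4]⟩
  | neg x _ hx =>
    obtain ⟨l, hl, h1, h2⟩ := hx
    exact ⟨-l, neg_mem hl, by simp [h1], by simp [h2]⟩

end CutProject

theorem theorem4 {N : ℕ}
    (L : AddSubgroup (EuclideanSpace ℝ (Fin N) × ℝ))
    (hL : CutProject.IsCutAndProjectScheme L)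
    (A : Matrix (Fin (N + 1)) (Fin (N + 1)) ℝ) (hA : A.det ≠ 0)
    (hLA : L = CutProject.matrixLattice A)
    (W : Set ℝ) (hW : CutProject.IsProperWindow W)
    (hmin : CutProject.IsMinimalHull (CutProject.modelSet L W))
    (i : Fin N) (hLi : CutProject.IsCutAndProjectScheme (CutProject.planarLattice A i))
    (B : ℕ → Set ℝ) (hB : CutProject.IsVanHove volume B)
    (hzero : CutProject.hullEntropy B
      (CutProject.modelSet (CutProject.planarLattice A i) W) = 0)
    (F : ℕ → Set (EuclideanSpace ℝ (Fin N))) (hF : CutProject.IsVanHove volume F) :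
    (∃ β, CutProject.IsTorusParametrisation L W β) ∧
      ∀ β, CutProject.IsTorusParametrisation L W β →
        ∀ ξ : (EuclideanSpace ℝ (Fin N) × ℝ) ⧸ L,
          CutProject.hullEntropyOn F (CutProject.modelSet L W)
            {Γ ∈ CutProject.hull (CutProject.modelSet L W) | β Γ = ξ} = 0 := by
  refine ⟨⟨_, CutProject.isTorusParametrisation_torusMap hL hW hmin⟩, fun β hβ ξ => ?_⟩
  -- The index `i` excludes `N = 0`, where the physical space would be compact.
  have : Nonempty (Fin N) := ⟨i⟩
  have : NoncompactSpace (EuclideanSpace ℝ (Fin N)) := NormedSpace.noncompactSpace ℝ _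
  refine le_antisymm ?_ (CutProject.entropyOn_nonneg (hβ.surjective ξ))
  refine (CutProject.entropyOn_mono fun Γ hΓ => hΓ.1).trans
    (CutProject.hullEntropy_le_zero hL hLi hW hmin hB hzero.le (fun x => x i) (fun z hz => ?_) hF)
  rw [hLA]
  exact CutProject.exists_mem_matrixLattice_of_mem_planarLattice A i hz
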